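/- All chain complexes and homology groups have $\mathbb Z_2$-coefficients. For a family $\mathcal F$ of subsets of a topological space $\mathbf R$ and an integer $k$ put $$TC_k(\mathcal F)=\sup\Bigl\{\widetilde\beta_i\bigl(\textstyle\bigcap\mathcal G;\mathbb Z_2\bigr) : \mathcal G\subseteq\mathcal F,\ 0\le i<k\Bigr\},$$ where $\widetilde\beta_i$ is the reduced Betti number (of singular homology), $\bigcap\emptyset=\mathbf R$, and the supremum of the empty set is $0$. For $S\subseteq \mathbf R$ let $\operatorname{conv}_{\mathcal F}S$ be the intersection of all members of $\mathcal F$ that contain $S$ (and $\mathbf R$ if there are none). Let $K$ be an abstract simplicial complex, regarded as containing the empty simplex, and let $\gamma\colon C_*(K)\to C_*(\mathbf R)$ be a chain map from the simplicial chains of $K$ to the singular chains of $\mathbf R$. The map $\gamma$ is *nontrivial* if it sends every vertex of $K$ to a sum of an odd number of distinct points of $\mathbf R$. For a (multi)set $P=\{p_i\}_{i\in I}$ of points of $\mathbf R$, indexed by a set $I$ (for an ordinary set $P$ take $I=P$), $\gamma$ is *constrained by* $(\mathcal F,P)$ if there is a map $\Phi\colon K\to 2^{I}$ such that $\Phi(\emptyset)=\emptyset$,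 $\Phi(\sigma\cap\tau)=\Phi(\sigma)\cap\Phi(\tau)$ for all $\sigma,\tau\in K$, and for every simplex $\sigma\in K$ the support of $\gamma(\sigma)$, that is, the union of the images of the singular simplices with nonzero coefficient in it, is contained in $\operatorname{conv}_{\mathcal F}\{p_i : i\in\Phi(\sigma)\}$. **Proposition.** For every finite simplicial complex $K$ and every integer $b\ge 0$ there is a constant $r_K(b)$ such that the following holds. Let $\mathcal F$ be a finite family of subsets of a topological space $\mathbf R$ with $TC_{\dim K}(\mathcal F)\le b$, and let $P$ be a (multi)set of at least $r_K(b)$ points of $\mathbf R$ (counted with multiplicity). Then there is a nontrivial chain map $\gamma\colon C_*(K)\to C_*(\mathbf R)$ that is constrained by $(\mathcal F,P)$. Furthermore, if $\dim K\le 1$, such a $\gamma$ can be found that is induced by a continuous map $f\colon|K|\to\mathbf R$ from the geometric realization of $K$, that is, $\gamma$ sends each simplex $\sigma$ to the singular simplex obtained by composing $f$ with the affine parametrization of $|\sigma|$ by a standard simplex. Here the parametrizations respect a linear order of the vertices of $K$, and $f$ can be chosen to work for all such orders. -/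

import Mathlib

noncomputable section

namespace ConstrainedChainMaps

universe u v w

/-! ### Singular chains and reduced Betti numbers, with coefficients in `ZMod 2` -/

section Singular

variable (X : Type v) [TopologicalSpace X]

/-- Singular `n`-simplices of `X`: continuous maps from the standard geometric `n`-simplex. -/
abbrev SingularSimplex (n : ℕ) : Type v := C(stdSimplex ℝ (Fin (n + 1)), X)

/-- Singular `n`-chains of `X` with coefficients in `ZMod 2`. -/
abbrev SingularChain (n : ℕ) : Type v := SingularSimplex X n →₀ ZMod 2

variable {X}

/-- The `i`-th face of a singular simplex: precomposition with the affine inclusion of the facet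
opposite to the `i`-th vertex. -/
def SingularSimplex.face {n : ℕ} (s : SingularSimplex X (n + 1)) (i : Fin (n + 2)) :
    SingularSimplex X n :=
  s.comp ⟨stdSimplex.map i.succAbove, stdSimplex.continuous_map _⟩

variable (X)

/-- The singular boundary map (no signs are needed modulo 2). -/
def singularBoundary (n : ℕ) : SingularChain X (n + 1) →ₗ[ZMod 2] SingularChain X n :=
  Finsupp.linearCombination (ZMod 2)
    (fun s : SingularSimplex X (n + 1) => ∑ i : Fin (n + 2), Finsupp.single (s.face i) 1)

/-- The augmentation, sending every point to `1`. -/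
def singularAugmentation : SingularChain X 0 →ₗ[ZMod 2] ZMod 2 :=
  Finsupp.linearCombination (ZMod 2) (fun _ : SingularSimplex X 0 => (1 : ZMod 2))

/-- Cycles of the augmented singular chain complex. -/
def reducedCycles : ∀ n : ℕ, Submodule (ZMod 2) (SingularChain X n)
  | 0 => LinearMap.ker (singularAugmentation X)
  | n + 1 => LinearMap.ker (singularBoundary X n)

/-- The boundaries, as a subspace of the space of cycles. -/
def reducedBoundaries (n : ℕ) : Submodule (ZMod 2) (reducedCycles X n) :=
  (LinearMap.range (singularBoundary X n)).comap (reducedCycles X n).subtype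

/-- Reduced singular homology with coefficients in `ZMod 2`: cycles modulo boundaries. -/
abbrev ReducedHomology (n : ℕ) : Type v := reducedCycles X n ⧸ reducedBoundaries X n

/-- The reduced Betti number over `ZMod 2`, which is `⊤` if the homology has infinite dimension. -/
def reducedBetti (n : ℕ) : ℕ∞ := Cardinal.toENat (Module.rank (ZMod 2) (ReducedHomology X n))

variable {X}

/-- The support of a singular chain: the union of the images of the singular simplices that occur
in it with nonzero coefficient. -/
def chainSupport {n : ℕ} (c : SingularChain X n) : Set X := ⋃ s ∈ c.support, Set.range s

/-- The `k`-level topological complexity of a family `F` of subsets of `X`: the supremum of the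
reduced Betti numbers in degrees `0 ≤ i < k` of the intersections of subfamilies of `F`, the
intersection of the empty subfamily being the whole space. -/
def topologicalComplexity (F : Set (Set X)) (k : WithBot ℕ∞) : ℕ∞ :=
  ⨆ (G : Set (Set X)) (_ : G ⊆ F) (i : ℕ) (_ : ((i : ℕ∞) : WithBot ℕ∞) < k),
    reducedBetti (⋂₀ G) i

/-- The convex hull of `S` relative to `F`: the intersection of all members of `F` that contain
`S`, which is the whole space if there is no such member. -/
def relConvexHull {X : Type v} (F : Set (Set X)) (S : Set X) : Set X := ⋂₀ {A ∈ F | S ⊆ A}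

end Singular

/-! ### Simplicial complexes

A `PreAbstractSimplicialComplex V` is a family of nonempty finite subsets of `V` that is closed
under passing to nonempty subsets; its vertices are the `v` such that `{v}` is a face. -/

section Simplicial

variable {V : Type u} (K : PreAbstractSimplicialComplex V)

/-- The dimension of a simplicial complex (`⊥` for the complex without vertices). -/
def simplicialDim : WithBot ℕ∞ :=
  ⨆ σ ∈ K.faces, (((σ.card - 1 : ℕ) : ℕ∞) : WithBot ℕ∞)

/-- The `n`-dimensional simplices of `K`. -/
def Simplex (n : ℕ) : Type u := {σ : Finset V // σ ∈ K.faces ∧ σ.card = n + 1}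

/-- Simplicial `n`-chains of `K` with coefficients in `ZMod 2`. -/
abbrev SimplicialChain (n : ℕ) : Type u := Simplex K n →₀ ZMod 2

variable {K}

open Classical in
/-- The facet of a simplex opposite to its vertex `v`. -/
def Simplex.facet {n : ℕ} (σ : Simplex K (n + 1)) (v : {v : V // v ∈ σ.1}) : Simplex K n :=
  ⟨σ.1.erase v.1, by
    have hc : (σ.1.erase v.1).card = n + 1 := by
      rw [Finset.card_erase_of_mem v.2, σ.2.2, Nat.add_sub_cancel]
    exact ⟨(K.isRelLowerSet_faces σ.2.1).2 (Finset.erase_subset _ _)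
      (Finset.card_pos.1 (by rw [hc]; exact Nat.succ_pos n)), hc⟩⟩

variable (K)

/-- The simplicial boundary map modulo 2. -/
def simplicialBoundary (n : ℕ) : SimplicialChain K (n + 1) →ₗ[ZMod 2] SimplicialChain K n :=
  Finsupp.linearCombination (ZMod 2)
    (fun σ : Simplex K (n + 1) => ∑ v ∈ σ.1.attach, Finsupp.single (σ.facet v) 1)

/-- The points of the geometric realization `|K|`, in barycentric coordinates. -/
def realization : Set (V → ℝ) :=
  {x | ∃ σ ∈ K.faces, (∀ v, 0 ≤ x v) ∧ (∀ v, v ∉ σ → x v = 0) ∧ ∑ v ∈ σ, x v = 1}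

/-- The geometric realization `|K|`, with the topology of pointwise convergence of the barycentric
coordinates; for a finite complex this is the usual topology. -/
abbrev Realization : Type u := realization K

variable {K}

open Classical in
/-- The affine map from the standard simplex to `|K|` that sends its `i`-th vertex to the vertex
`e i`, where the `e i` are the distinct vertices of a simplex of `K`. -/
def characteristicMap {n : ℕ} (e : Fin (n + 1) ↪ V) (he : Finset.univ.map e ∈ K.faces) :
    C(stdSimplex ℝ (Fin (n + 1)), Realization K) where
  toFun t := ⟨fun v => ∑ i, if e i = v then t i else 0, Finset.univ.map e, he,
    fun v => Finset.sum_nonneg fun i _ => by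
      split_ifs
      · exact stdSimplex.zero_le t i
      · exact le_rfl,
    fun v hv => Finset.sum_eq_zero fun i _ => if_neg fun h =>
      hv (Finset.mem_map.2 ⟨i, Finset.mem_univ i, h⟩),
    by simp [Finset.sum_map]⟩
  continuous_toFun := by
    refine Continuous.subtype_mk (continuous_pi fun v => ?_) _
    refine continuous_finsetSum _ fun i _ => ?_
    split_ifs
    · exact (continuous_apply i).comp continuous_subtype_val
    · exact continuous_const

end Simplicial

/-! ### Chain maps from simplicial to singular chains -/

/-- A chain map from the simplicial chains of `K` to the singular chains of `X`, with coefficients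
in `ZMod 2`. -/
structure ChainMap {V : Type u} (K : PreAbstractSimplicialComplex V) (X : Type v)
    [TopologicalSpace X] where
  /-- The components of the chain map. -/
  app : ∀ n : ℕ, SimplicialChain K n →ₗ[ZMod 2] SingularChain X n
  /-- Compatibility with the boundary maps. -/
  comm : ∀ (n : ℕ) (c : SimplicialChain K (n + 1)),
    singularBoundary X n (app (n + 1) c) = app n (simplicialBoundary K n c)

namespace ChainMap

variable {V : Type u} {K : PreAbstractSimplicialComplex V} {X : Type v} [TopologicalSpace X]

/-- The image of a simplex under a chain map. -/
def onSimplex (γ : ChainMap K X) {n : ℕ} (σ : Simplex K n) : SingularChain X n :=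
  γ.app n (Finsupp.single σ 1)

/-- A chain map is nontrivial if it sends every vertex to a sum of an odd number of points. -/
def Nontrivial (γ : ChainMap K X) : Prop :=
  ∀ v : Simplex K 0, Odd (γ.onSimplex v).support.card

open Classical in
/-- `γ` is constrained by `(F, Φ)`, where `F` is a family of sets in `X`, the points `p i` form
a (multi)set indexed by `ι`, and `Φ` assigns to each simplex, and to the empty simplex, a set of
indices. If `p` is the inclusion of a set `P ⊆ X`, then `ι = P` and `Φ` takes values in the
subsets of `P`. -/
def IsConstrainedWith {ι : Type w} (γ : ChainMap K X) (F : Set (Set X)) (p : ι → X)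
    (Φ : Finset V → Set ι) : Prop :=
  Φ ∅ = ∅ ∧
  (∀ σ ∈ K.faces, ∀ τ ∈ K.faces, Φ (σ ∩ τ) = Φ σ ∩ Φ τ) ∧
  ∀ (n : ℕ) (σ : Simplex K n), chainSupport (γ.onSimplex σ) ⊆ relConvexHull F (p '' Φ σ.1)

/-- `γ` is constrained by `(F, P)`, where `P` is the (multi)set of the points `p i`. -/
def IsConstrainedBy {ι : Type w} (γ : ChainMap K X) (F : Set (Set X)) (p : ι → X) : Prop :=
  ∃ Φ : Finset V → Set ι, γ.IsConstrainedWith F p Φ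

/-- `γ` is induced by `f : |K| → X`: it sends each simplex `σ` to the singular simplex obtained by
composing `f` with the affine parametrization of `|σ|` by a standard simplex that respects
a given linear order of the vertices. -/
def IsInducedBy [LinearOrder V] (γ : ChainMap K X) (f : C(Realization K, X)) : Prop :=
  ∀ (n : ℕ) (e : Fin (n + 1) ↪o V) (he : Finset.univ.map e.toEmbedding ∈ K.faces),
    γ.onSimplex ⟨Finset.univ.map e.toEmbedding, he, by simp⟩ =
      Finsupp.single (f.comp (characteristicMap e.toEmbedding he)) 1

end ChainMap

end ConstrainedChainMaps

end

open ConstrainedChainMaps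

/-!
The chain map is built one skeleton at a time, on the full simplex with vertex set `Fin N`; a chain
map on a complex `K` is obtained by restriction. On the `0`-skeleton one sends distinct vertices to
distinct points of the family `p`.

Suppose that a constrained chain map `g` on the `k`-skeleton of a huge simplex is given. For a set
`T` of `t` vertices let `A_T` be the relative convex hull of the points used by the simplices in
`T`. The `g`-images of the boundaries of the `(k + 1)`-simplices in `T` are `k`-cycles in `A_T`, and
as the `k`-th Betti number of `A_T` is at most `b`, a linear map to `(ZMod 2) ^ b` decides which
combinations of them bound in `A_T` (`exists_detecting_map`). By Ramsey's theorem
(`exists_homogeneous`), `T` contains a set `M` of `2 * (k + 2)` vertices such that all these cycles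
in `M` have the same class `h`. Since the boundaries of the `k + 3` facets of a `(k + 2)`-simplex
add up to zero, `(k + 3) • h = 0` (`smul_eq_zero_of_homogeneous`).

The new chain map sends a `k`-simplex `σ` to the image of the cone, with an apex `a σ` of its own,
over the boundary of `σ`. The boundary of a `(k + 1)`-simplex `σ` then goes to the sum of the cycles
of `k + 3` simplices, namely of `σ` itself and of the cones over its facets
(`boundaryImage_coneImage`). If all vertices involved lie in the set `M` belonging to some `T`, the
class of this sum in `A_T` is `(k + 3) • h = 0`, so that it can be filled in `A_T`
(`IsConstrainedSkeleton.extend`). The sets `T` for different `σ` must not share vertices other than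
those of their common faces. A second application of Ramsey's theorem, now to the position of `M`
inside `T`, makes this possible (`exists_placement`).

In dimension at most one, all vertices are sent to single points. The ends of an edge are then
joined by a `1`-chain, hence by a path, in the relevant hull (`joinedIn_of_boundary`), and these
paths form a map `|K| → X`.
-/

namespace ConstrainedChainMaps

open Finset

universe u v w

/-! ### Ramsey's theorem -/

/-- Off-diagonal recursion step of Ramsey's theorem: if colourings of `t`-sets have large
homogeneous sets, then colourings of `(t + 1)`-sets have, for some colour `k`, a homogeneous set of
colour `k` and of prescribed size `a k`. -/
theorem exists_homogeneous_offDiagonal.{x} {κ : Type*} [Finite κ] (t : ℕ)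
    (ih : ∀ m : ℕ, ∃ N : ℕ, ∀ {α : Type x} [DecidableEq α] (S : Finset α) (c : Finset α → κ),
      N ≤ #S → ∃ Q ⊆ S, #Q = m ∧ ∃ k, ∀ T ⊆ Q, #T = t → c T = k)
    (s : ℕ) (a : κ → ℕ) (ha : ∑ᶠ k, a k = s) :
    ∃ N : ℕ, ∀ {α : Type x} [DecidableEq α] (S : Finset α) (c : Finset α → κ),
      N ≤ #S → ∃ Q ⊆ S, ∃ k, #Q = a k ∧ ∀ T ⊆ Q, #T = t + 1 → c T = k := by
  classical
  have := Fintype.ofFinite κ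
  induction s generalizing a with
  | zero =>
    refine ⟨0, fun S c _ => ⟨∅, by simp, c ∅, ?_, ?_⟩⟩
    · rw [finsum_eq_sum_of_fintype, Finset.sum_eq_zero_iff] at ha
      simp [ha]
    · intro T hT h
      rw [Finset.subset_empty.1 hT] at h
      simp at h
  | succ s ihs =>
    by_cases h0 : ∃ k, a k = 0
    · obtain ⟨k, hk⟩ := h0
      refine ⟨0, fun S c _ => ⟨∅, by simp, k, by simp [hk], ?_⟩⟩
      intro T hT h
      rw [Finset.subset_empty.1 hT] at h
      simp at h
    · push Not at h0
      have hdec : ∀ k, ∃ N : ℕ, ∀ {α : Type x} [DecidableEq α] (S : Finset α)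
          (c : Finset α → κ), N ≤ #S →
          ∃ Q ⊆ S, ∃ l, #Q = Function.update a k (a k - 1) l ∧
            ∀ T ⊆ Q, #T = t + 1 → c T = l := by
        intro k
        apply ihs
        rw [finsum_eq_sum_of_fintype] at ha ⊢
        rw [Finset.sum_update_of_mem (Finset.mem_univ k)]
        rw [← Finset.add_sum_erase _ _ (Finset.mem_univ k), ← Finset.sdiff_singleton_eq_erase]
          at ha
        have := h0 k
        omega
      choose N hN using hdec
      obtain ⟨N', hN'⟩ := ih (Finset.univ.sup N)
      refine ⟨N' + 1, fun {α} _ S c hS => ?_⟩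
      obtain ⟨x, hx⟩ : S.Nonempty := Finset.card_pos.1 (by omega)
      obtain ⟨S₁, hS₁, hcard, k, hk⟩ := hN' (S.erase x) (fun T => c (insert x T))
        (by rw [Finset.card_erase_of_mem hx]; omega)
      obtain ⟨Q, hQ, l, hl, hcol⟩ := hN k S₁ c
        (hcard ▸ Finset.le_sup (f := N) (Finset.mem_univ k))
      have hxS : x ∉ S₁ := fun h => (Finset.mem_erase.1 (hS₁ h)).1 rfl
      have hSS : S₁ ⊆ S := hS₁.trans (Finset.erase_subset _ _)
      by_cases hlk : l = k
      · subst hlk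
        refine ⟨insert x Q, Finset.insert_subset hx (hQ.trans hSS), l, ?_, fun T hT hTc => ?_⟩
        · rw [Finset.card_insert_of_notMem fun h => hxS (hQ h), hl, Function.update_self]
          have := h0 l
          omega
        · by_cases hxT : x ∈ T
          · rw [← Finset.insert_erase hxT]
            refine hk _ ?_ (by rw [Finset.card_erase_of_mem hxT, hTc]; rfl)
            exact (Finset.subset_insert_iff.1 hT).trans hQ
          · exact hcol T ((Finset.subset_insert_iff_of_notMem hxT).1 hT) hTc
      · exact ⟨Q, hQ.trans hSS, l, by rw [hl, Function.update_of_ne hlk], hcol⟩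

/-- **Ramsey's theorem** for colourings of the `t`-element subsets of a finite set. -/
theorem exists_homogeneous.{x} {κ : Type*} [Finite κ] (t m : ℕ) :
    ∃ N : ℕ, ∀ {α : Type x} [DecidableEq α] (S : Finset α) (c : Finset α → κ),
      N ≤ #S → ∃ Q ⊆ S, #Q = m ∧ ∃ k, ∀ T ⊆ Q, #T = t → c T = k := by
  induction t generalizing m with
  | zero =>
    refine ⟨m, fun S c hS => ?_⟩
    obtain ⟨Q, hQ, hc⟩ := Finset.exists_subset_card_eq hS
    exact ⟨Q, hQ, hc, c ∅, fun T _ hT => by rw [Finset.card_eq_zero.1 hT]⟩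
  | succ t ih =>
    obtain ⟨N, hN⟩ := exists_homogeneous_offDiagonal.{x} (κ := κ) t ih _ (fun _ => m) rfl
    exact ⟨N, fun S c hS => by
      obtain ⟨Q, hQ, k, hc, hk⟩ := hN S c hS
      exact ⟨Q, hQ, hc, k, hk⟩⟩

/-- Given a marked `m`-element subset `M T` of every `t`-element set `T`, and prescribed
`m`-element sets `μ b` of labels, the labels can be placed injectively, by `u`, so that each `μ b`
becomes the marked subset of some set `T b`; the additional elements of `T b` are not labels and
belong to no other `T b'`. -/
theorem exists_placement {α β : Type*} [Fintype α] [Fintype β] [DecidableEq α]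
    (m t : ℕ) (μ : β → Finset α) (hμ : ∀ b, #(μ b) = m) :
    ∃ N : ℕ, ∀ M : Finset (Fin N) → Finset (Fin N), (∀ T, #T = t → M T ⊆ T ∧ #(M T) = m) →
      ∃ (u : α ↪ Fin N) (T : β → Finset (Fin N)), (∀ b, #(T b) = t) ∧
        (∀ b, M (T b) = (μ b).map u) ∧ (∀ b a, u a ∈ T b ↔ a ∈ μ b) ∧
        ∀ b b', b ≠ b' → ∀ x ∈ T b, x ∈ T b' → ∃ a, u a = x := by
  classical
  let ca := Fintype.equivFin α
  let cb := Fintype.equivFin β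
  set n := Fintype.card α
  set s := Fintype.card β
  set G := s * t + 1 with hG
  set q := (n + 1) * G with hq
  obtain ⟨N, hN⟩ := exists_homogeneous.{0} (κ := Finset (Fin t)) t q
  refine ⟨N, fun M hM => ?_⟩
  -- The colour of a `t`-set is the set of positions of its marked elements.
  obtain ⟨Q, -, hQ, D, hD⟩ := hN (α := Fin N) Finset.univ
    (fun T => if h : #T = t then Finset.univ.filter fun j => T.orderEmbOfFin h j ∈ M T else ∅)
    (by simp)
  let f : Fin q ↪o Fin N := Q.orderEmbOfFin hQ
  have hfQ : ∀ x, f x ∈ Q := fun x => Q.orderEmbOfFin_mem hQ x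
  -- A label sits at a positive multiple of `G`; the gaps in between have room for the additional
  -- elements of all the sets `T b`.
  have hpos : ∀ c o, c ≤ n → o < G → c * G + o < q := by
    intro c o hc ho
    calc c * G + o < c * G + G := by omega
      _ = (c + 1) * G := by ring
      _ ≤ q := Nat.mul_le_mul_right _ (by omega)
  have hGpos : 0 < G := Nat.succ_pos _
  have hinj : ∀ c o c' o', o < G → o' < G → c * G + o = c' * G + o' → c = c' ∧ o = o' := by
    intro c o c' o' ho ho' h
    have h1 := congrArg (· / G) h
    have h2 := congrArg (· % G) h
    simp only [mul_comm _ G, Nat.mul_add_div hGpos, Nat.mul_add_mod, Nat.div_eq_of_lt ho,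
      Nat.div_eq_of_lt ho', Nat.mod_eq_of_lt ho, Nat.mod_eq_of_lt ho'] at h1 h2
    exact ⟨by simpa using h1, h2⟩
  let u : α ↪ Fin N :=
    ⟨fun a => f ⟨((ca a : ℕ) + 1) * G + 0, hpos _ _ (ca a).2 hGpos⟩, fun a a' h => by
      have := hinj _ _ _ _ hGpos hGpos (Fin.mk.inj_iff.1 (f.injective h))
      exact ca.injective (Fin.ext (by omega))⟩
  have key : ∀ b, ∃ (T : Finset (Fin N)) (base off : Fin t → ℕ),
      #T = t ∧ M T = (μ b).map u ∧ (∀ j, off j < G) ∧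
      (∀ j, off j = 0 ∨ off j = 1 + (cb b : ℕ) * t + j) ∧
      (∀ j, off j = 0 → ∃ a ∈ μ b, base j = (ca a : ℕ) + 1) ∧
      (∀ a ∈ μ b, u a ∈ T) ∧
      ∀ x ∈ T, ∃ j, ∃ h : base j * G + off j < q, x = f ⟨base j * G + off j, h⟩ := by
    intro b
    have hoff : ∀ j : Fin t, 1 + (cb b : ℕ) * t + j < G := by
      intro j
      have h1 : ((cb b : ℕ) + 1) * t ≤ s * t := Nat.mul_le_mul_right _ (cb b).2
      have := j.2
      rw [hG]
      linarith [add_mul (cb b : ℕ) 1 t]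
    have htq : t ≤ q := by
      have h1 : 1 * t ≤ s * t := Nat.mul_le_mul_right _ (Nat.one_le_iff_ne_zero.2 (by
        have := (cb b).2; omega))
      have := hpos 0 (s * t) (Nat.zero_le _) (by omega)
      omega
    have hDm : #D = m := by
      obtain ⟨T, hT, hTc⟩ := Finset.exists_subset_card_eq (hQ ▸ htq : t ≤ #Q)
      have h1 := hD T hT hTc
      rw [dif_pos hTc] at h1
      obtain ⟨hs, hc⟩ := hM T hTc
      rw [← h1, ← hc, ← Finset.card_map (T.orderEmbOfFin hTc).toEmbedding]
      congr 1
      ext x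
      simp only [Finset.mem_map, Finset.mem_filter, Finset.mem_univ, true_and]
      constructor
      · rintro ⟨j, hj, rfl⟩
        exact hj
      · intro hx
        have : x ∈ Set.range (T.orderEmbOfFin hTc) := by
          rw [Finset.range_orderEmbOfFin]
          exact hs hx
        obtain ⟨j, rfl⟩ := this
        exact ⟨j, hx, rfl⟩
    set C : Finset ℕ := (μ b).image fun a => (ca a : ℕ) + 1 with hC
    have hCm : #C = m := by
      rw [hC, Finset.card_image_of_injective _ fun a a' h => ca.injective (Fin.ext (by
        simpa using h)), hμ]
    let e' : D ≃o C := (D.orderIsoOfFin hDm).symm.trans (C.orderIsoOfFin hCm)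
    let e : Fin t → ℕ := fun j => if h : j ∈ D then e' ⟨j, h⟩ else 0
    have he : ∀ j (h : j ∈ D), e j = e' ⟨j, h⟩ := fun j h => dif_pos h
    have heC : ∀ j ∈ D, e j ∈ C := fun j h => he j h ▸ (e' ⟨j, h⟩).2
    have hemono : ∀ i ∈ D, ∀ j ∈ D, i < j → e i < e j := by
      intro i hi j hj hij
      rw [he i hi, he j hj]
      exact e'.lt_iff_lt.2 hij
    have hCle : ∀ c ∈ C, 0 < c ∧ c ≤ n := by
      intro c hc
      obtain ⟨a, -, rfl⟩ := Finset.mem_image.1 hc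
      exact ⟨Nat.succ_pos _, (ca a).2⟩
    -- `base j` is the number of the last label at or before the `j`-th element of the future set
    -- `T b`, and `0` if there is none. The offsets of additional elements lie in a block that
    -- depends on `b`, which keeps these elements private to `T b`.
    let base : Fin t → ℕ := fun j => (D.filter (· ≤ j)).sup e
    let off : Fin t → ℕ := fun j => if j ∈ D then 0 else 1 + (cb b : ℕ) * t + j
    have hbaseD : ∀ j ∈ D, base j = e j := by
      intro j hj
      refine le_antisymm (Finset.sup_le fun i hi => ?_) (Finset.le_sup (f := e) (by simp [hj]))
      obtain ⟨hi, hij⟩ := Finset.mem_filter.1 hi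
      rcases hij.lt_or_eq with h | rfl
      · exact (hemono i hi j hj h).le
      · exact le_rfl
    have hbase_le : ∀ j, base j ≤ n := fun j => Finset.sup_le fun i hi =>
      (hCle _ (heC i (Finset.mem_filter.1 hi).1)).2
    have hoffG : ∀ j, off j < G := by
      intro j
      by_cases h : j ∈ D
      · simpa [off, h] using hGpos
      · simpa [off, h] using hoff j
    let P : Fin t → Fin q := fun j => ⟨base j * G + off j, hpos _ _ (hbase_le j) (hoffG j)⟩
    have hP : StrictMono P := by
      intro i j hij
      change base i * G + off i < base j * G + off j
      have hle : base i ≤ base j := Finset.sup_mono fun x hx => by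
        simp only [Finset.mem_filter] at hx ⊢
        exact ⟨hx.1, hx.2.trans hij.le⟩
      have step : base i < base j → base i * G + off i < base j * G + off j := by
        intro h
        calc base i * G + off i < base i * G + G := by have := hoffG i; omega
          _ = (base i + 1) * G := by ring
          _ ≤ base j * G := Nat.mul_le_mul_right _ h
          _ ≤ _ := Nat.le_add_right _ _
      by_cases hj : j ∈ D
      · apply step
        rw [hbaseD j hj]
        refine (Finset.sup_lt_iff (hCle _ (heC j hj)).1).2 fun x hx => ?_
        obtain ⟨hx, hxi⟩ := Finset.mem_filter.1 hx
        exact hemono x hx j hj (hxi.trans_lt hij)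
      · rcases hle.lt_or_eq with h | h
        · exact step h
        · rw [h]
          have : off i < off j := by
            by_cases hi : i ∈ D
            · simp only [off, hi, hj, if_true, if_false]; omega
            · simp only [off, hi, hj, if_false]
              have : (i : ℕ) < j := hij
              omega
          omega
    let T : Finset (Fin N) := Finset.univ.image fun j => f (P j)
    have hfP : StrictMono fun j => f (P j) := f.strictMono.comp hP
    have hTc : #T = t := by
      rw [Finset.card_image_of_injective _ hfP.injective, Finset.card_univ, Fintype.card_fin]
    have hTQ : T ⊆ Q := by
      intro x hx
      obtain ⟨j, -, rfl⟩ := Finset.mem_image.1 hx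
      exact hfQ _
    have hemb : (fun j => f (P j)) = T.orderEmbOfFin hTc :=
      Finset.orderEmbOfFin_unique hTc (fun j => Finset.mem_image_of_mem _ (Finset.mem_univ j)) hfP
    have hMT : ∀ j, f (P j) ∈ M T ↔ j ∈ D := by
      intro j
      have h1 := hD T hTQ hTc
      rw [dif_pos hTc, ← hemb] at h1
      rw [← h1]
      simp
    have hPu : ∀ j ∈ D, ∀ a, e j = (ca a : ℕ) + 1 → f (P j) = u a := by
      intro j hj a h
      refine congrArg f (Fin.ext ?_)
      change base j * G + off j = ((ca a : ℕ) + 1) * G + 0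
      rw [hbaseD j hj, h]
      simp [off, hj]
    have hsurj : ∀ a ∈ μ b, ∃ j ∈ D, e j = (ca a : ℕ) + 1 := by
      intro a ha
      obtain ⟨⟨j, hj⟩, h⟩ := e'.surjective ⟨(ca a : ℕ) + 1, Finset.mem_image_of_mem _ ha⟩
      exact ⟨j, hj, by rw [he j hj, h]⟩
    refine ⟨T, base, off, hTc, ?_, hoffG, ?_, ?_, ?_, ?_⟩
    · ext x
      rw [Finset.mem_map]
      constructor
      · intro hx
        obtain ⟨j, -, rfl⟩ := Finset.mem_image.1 ((hM T hTc).1 hx)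
        have hj := (hMT j).1 hx
        obtain ⟨a, ha, h⟩ := Finset.mem_image.1 (heC j hj)
        exact ⟨a, ha, (hPu j hj a h.symm).symm⟩
      · rintro ⟨a, ha, rfl⟩
        obtain ⟨j, hj, h⟩ := hsurj a ha
        rw [← hPu j hj a h]
        exact (hMT j).2 hj
    · intro j
      by_cases h : j ∈ D
      · exact Or.inl (if_pos h)
      · exact Or.inr (if_neg h)
    · intro j hj
      have hjD : j ∈ D := by
        by_contra h
        simp only [off, if_neg h] at hj
        omega
      obtain ⟨a, ha, h⟩ := Finset.mem_image.1 (heC j hjD)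
      exact ⟨a, ha, by rw [hbaseD j hjD, h]⟩
    · intro a ha
      obtain ⟨j, hj, h⟩ := hsurj a ha
      rw [← hPu j hj a h]
      exact Finset.mem_image_of_mem _ (Finset.mem_univ j)
    · intro x hx
      obtain ⟨j, -, rfl⟩ := Finset.mem_image.1 hx
      exact ⟨j, (P j).2, rfl⟩
  choose T base off hTc hMT hoffG hoff hbase hmem hform using key
  refine ⟨u, T, hTc, hMT, fun b a => ⟨fun h => ?_, hmem b a⟩, fun b b' hb x hx hx' => ?_⟩
  · obtain ⟨j, hj, h⟩ := hform b _ h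
    obtain ⟨h1, h2⟩ := hinj _ _ _ _ hGpos (hoffG b j) (Fin.mk.inj_iff.1 (f.injective h))
    obtain ⟨a', ha', h3⟩ := hbase b j h2.symm
    have : a = a' := ca.injective (Fin.ext (by omega))
    exact this ▸ ha'
  · obtain ⟨j, hj, h⟩ := hform b _ hx
    obtain ⟨j', hj', h'⟩ := hform b' _ hx'
    obtain ⟨h1, h2⟩ := hinj _ _ _ _ (hoffG b j) (hoffG b' j')
      (Fin.mk.inj_iff.1 (f.injective (h.symm.trans h')))
    have h0 : off b j = 0 := by
      by_contra h0
      have e1 := (hoff b j).resolve_left h0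
      have e2 := (hoff b' j').resolve_left (h2 ▸ h0)
      obtain ⟨h3, -⟩ : (cb b : ℕ) = cb b' ∧ (j : ℕ) = j' := by
        have h4 : t * (cb b : ℕ) + j = t * (cb b' : ℕ) + j' := by
          rw [mul_comm t, mul_comm t]; omega
        have ht : 0 < t := by have := j.2; omega
        have h5 := congrArg (· / t) h4
        have h6 := congrArg (· % t) h4
        simp only [Nat.mul_add_div ht, Nat.mul_add_mod, Nat.div_eq_of_lt j.2,
          Nat.div_eq_of_lt j'.2, Nat.mod_eq_of_lt j.2, Nat.mod_eq_of_lt j'.2] at h5 h6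
        exact ⟨by simpa using h5, h6⟩
      exact hb (cb.injective (Fin.ext h3))
    obtain ⟨a, -, ha⟩ := hbase b j h0
    refine ⟨a, h ▸ congrArg f (Fin.ext ?_)⟩
    change ((ca a : ℕ) + 1) * G + 0 = base b j * G + off b j
    rw [ha, h0]

/-! ### Singular chains supported in a subset -/

theorem relConvexHull_mono {X : Type v} (F : Set (Set X)) {S T : Set X} (h : S ⊆ T) :
    relConvexHull F S ⊆ relConvexHull F T :=
  Set.sInter_subset_sInter fun _ hA => ⟨hA.1, h.trans hA.2⟩

theorem subset_relConvexHull {X : Type v} (F : Set (Set X)) (S : Set X) : S ⊆ relConvexHull F S :=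
  Set.subset_sInter fun _ hA => hA.2

section Singular

variable {X : Type v} [TopologicalSpace X]

/-- The singular `n`-chains of `X` all of whose simplices have image in `A`. -/
def chainsIn (A : Set X) (n : ℕ) : Submodule (ZMod 2) (SingularChain X n) :=
  Finsupp.supported (ZMod 2) (ZMod 2) {s : SingularSimplex X n | Set.range s ⊆ A}

theorem mem_chainsIn {A : Set X} {n : ℕ} {c : SingularChain X n} :
    c ∈ chainsIn A n ↔ chainSupport c ⊆ A := by
  rw [chainsIn, Finsupp.mem_supported, chainSupport, Set.iUnion₂_subset_iff]
  rfl

theorem chainsIn_mono {A B : Set X} (h : A ⊆ B) (n : ℕ) : chainsIn A n ≤ chainsIn B n :=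
  Finsupp.supported_mono fun _ hs => Set.Subset.trans hs h

theorem single_mem_chainsIn {A : Set X} {n : ℕ} {s : SingularSimplex X n} {a : ZMod 2}
    (h : Set.range s ⊆ A) : Finsupp.single s a ∈ chainsIn A n :=
  Finsupp.single_mem_supported _ _ h

/-- The map of singular chains induced by the inclusion of a subset. -/
noncomputable def chainInclusion (A : Set X) (n : ℕ) :
    SingularChain A n →ₗ[ZMod 2] SingularChain X n :=
  Finsupp.lmapDomain _ _ fun s : SingularSimplex A n =>
    (⟨_, continuous_subtype_val⟩ : C(A, X)).comp s

theorem chainInclusion_injective (A : Set X) (n : ℕ) :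
    Function.Injective (chainInclusion A n) := by
  refine Finsupp.mapDomain_injective fun s t h => ?_
  ext x
  exact congrArg (fun f : SingularSimplex X n => f x) h

theorem exists_chainInclusion_eq {A : Set X} {n : ℕ} {c : SingularChain X n}
    (hc : c ∈ chainsIn A n) : ∃ c', chainInclusion A n c' = c := by
  have h : chainsIn A n ≤ LinearMap.range (chainInclusion A n) := by
    rw [chainsIn, Finsupp.supported_eq_span_single, Submodule.span_le]
    rintro _ ⟨s, hs, rfl⟩
    refine ⟨Finsupp.single ⟨fun t => ⟨s t, hs ⟨t, rfl⟩⟩, by fun_prop⟩ 1, ?_⟩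
    rw [chainInclusion, Finsupp.lmapDomain_apply, Finsupp.mapDomain_single]
    rfl
  exact h hc

theorem chainInclusion_mem (A : Set X) {n : ℕ} (c : SingularChain A n) :
    chainInclusion A n c ∈ chainsIn A n := by
  induction c using Finsupp.induction_linear with
  | zero => simp
  | add c d hc hd => rw [map_add]; exact add_mem hc hd
  | single s a =>
    rw [chainInclusion, Finsupp.lmapDomain_apply, Finsupp.mapDomain_single]
    exact single_mem_chainsIn (by rintro _ ⟨x, rfl⟩; exact (s x).2)

theorem singularBoundary_chainInclusion (A : Set X) (n : ℕ) (c : SingularChain A (n + 1)) :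
    singularBoundary X n (chainInclusion A (n + 1) c) =
      chainInclusion A n (singularBoundary A n c) := by
  induction c using Finsupp.induction_linear with
  | zero => simp
  | add c d hc hd => simp only [map_add, hc, hd]
  | single s a =>
    simp only [chainInclusion, singularBoundary, Finsupp.lmapDomain_apply,
      Finsupp.mapDomain_single, Finsupp.linearCombination_single, Finsupp.mapDomain_smul,
      Finsupp.mapDomain_finsetSum]
    rfl

theorem singularAugmentation_chainInclusion (A : Set X) (c : SingularChain A 0) :
    singularAugmentation X (chainInclusion A 0 c) = singularAugmentation A c := by
  induction c using Finsupp.induction_linear with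
  | zero => simp
  | add c d hc hd => simp only [map_add, hc, hd]
  | single s a =>
    simp [chainInclusion, singularAugmentation, Finsupp.mapDomain_single]

theorem mem_reducedCycles_of_chainInclusion {A : Set X} {n : ℕ} {c : SingularChain A n}
    (h : chainInclusion A n c ∈ reducedCycles X n) : c ∈ reducedCycles A n := by
  cases n with
  | zero =>
    change singularAugmentation A c = 0
    rw [← singularAugmentation_chainInclusion]
    exact h
  | succ n =>
    change singularBoundary A n c = 0
    apply chainInclusion_injective
    rw [← singularBoundary_chainInclusion, map_zero]
    exact h

/-- If `A` has small `n`-th reduced Betti number, then finitely many linear functionals on the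
chains of `X` detect whether a cycle in `A` bounds in `A`. -/
theorem exists_detecting_map {A : Set X} {n b : ℕ} (h : reducedBetti A n ≤ b) :
    ∃ φ : SingularChain X n →ₗ[ZMod 2] (Fin b → ZMod 2),
      ∀ z ∈ chainsIn A n, z ∈ reducedCycles X n → φ z = 0 →
        ∃ c ∈ chainsIn A (n + 1), singularBoundary X n c = z := by
  have hr : Module.rank (ZMod 2) (ReducedHomology A n) ≤ b := Cardinal.toENat_le_natCast.1 h
  have hfin : Module.Finite (ZMod 2) (ReducedHomology A n) :=
    Module.rank_lt_aleph0_iff.1 (hr.trans_lt (Cardinal.natCast_lt_aleph0))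
  obtain ⟨j, hj⟩ : ∃ j : ReducedHomology A n →ₗ[ZMod 2] (Fin b → ZMod 2),
      Function.Injective j :=
    finrank_le_iff_exists_linearMap.1 (by
      rw [Module.finrank_fin_fun]
      exact Module.finrank_le_of_rank_le hr)
  obtain ⟨ψ, hψ⟩ := LinearMap.exists_extend (j ∘ₗ (reducedBoundaries A n).mkQ)
  obtain ⟨r, hr⟩ := (chainInclusion A n).exists_leftInverse_of_injective
    (LinearMap.ker_eq_bot.2 (chainInclusion_injective A n))
  refine ⟨ψ ∘ₗ r, fun z hz hzc h0 => ?_⟩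
  obtain ⟨w, rfl⟩ := exists_chainInclusion_eq hz
  have hw := mem_reducedCycles_of_chainInclusion hzc
  have h1 : r (chainInclusion A n w) = w := LinearMap.congr_fun hr w
  have h2 : ψ w = j ((reducedBoundaries A n).mkQ ⟨w, hw⟩) := LinearMap.congr_fun hψ ⟨w, hw⟩
  rw [LinearMap.comp_apply, h1, h2, ← map_zero j] at h0
  have h3 := (Submodule.Quotient.mk_eq_zero _).1 (hj h0)
  obtain ⟨c, hc⟩ := h3
  exact ⟨chainInclusion A (n + 1) c, chainInclusion_mem A c, by
    rw [singularBoundary_chainInclusion, hc]; rfl⟩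

/-- The singular `0`-simplex at a point. -/
def pointSimplex (x : X) : SingularSimplex X 0 := ContinuousMap.const _ x

/-- Two points that form the boundary of a `1`-chain in `A` are joined by a path in `A`. -/
theorem joinedIn_of_boundary {A : Set X} {x y : X} (hx : x ∈ A) {c : SingularChain X 1}
    (hc : c ∈ chainsIn A 1)
    (h : singularBoundary X 0 c =
      Finsupp.single (pointSimplex x) 1 + Finsupp.single (pointSimplex y) 1) :
    JoinedIn A x y := by
  classical
  -- The functional that counts the points in the path component of `x` kills boundaries.
  let χ : SingularChain X 0 →ₗ[ZMod 2] ZMod 2 :=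
    Finsupp.linearCombination (ZMod 2) fun s => if JoinedIn A x (s default) then 1 else 0
  have key : ∀ c ∈ chainsIn A 1, χ (singularBoundary X 0 c) = 0 := by
    intro c hc
    change χ (c.sum fun s a => a • _) = 0
    rw [Finsupp.sum, map_sum]
    refine Finset.sum_eq_zero fun s hs => ?_
    have hsA : Set.range s ⊆ A := hc hs
    have hj : JoinedIn A (s.face 0 default) (s.face 1 default) := by
      have := (isPathConnected_range s.continuous).joinedIn (s.face 0 default) ⟨_, rfl⟩
        (s.face 1 default) ⟨_, rfl⟩
      exact this.mono hsA
    have hiff : JoinedIn A x (s.face 0 default) ↔ JoinedIn A x (s.face 1 default) :=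
      ⟨fun h => h.trans hj, fun h => h.trans hj.symm⟩
    have hb : ∑ i : Fin (0 + 2), Finsupp.single (s.face i) (1 : ZMod 2) =
        Finsupp.single (s.face 0) 1 + Finsupp.single (s.face 1) 1 := Fin.sum_univ_two _
    beta_reduce
    rw [hb, map_smul, map_add]
    simp only [χ, Finsupp.linearCombination_single, hiff]
    rw [CharTwo.add_self_eq_zero, smul_zero]
  have h1 := key c hc
  rw [h, map_add] at h1
  by_contra hn
  simp [χ, pointSimplex, hn, JoinedIn.refl hx] at h1

end Singular

/-! ### Constrained chain maps on skeleta of a simplex -/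

theorem sum_sum_erase_eq_zero {V M : Type*} [DecidableEq V] [AddCommGroup M] [Module (ZMod 2) M]
    (σ : Finset V) (f : V → V → M) (hf : ∀ v w, f v w = f w v) :
    ∑ v ∈ σ, ∑ w ∈ σ.erase v, f v w = 0 := by
  rw [Finset.sum_sigma']
  refine Finset.sum_involution (fun x _ => ⟨x.2, x.1⟩) ?_ ?_ ?_ ?_
  · intro x _
    rw [hf x.2 x.1]
    exact ZModModule.add_self _
  · rintro ⟨v, w⟩ h _ h'
    simp only [Finset.mem_sigma, Finset.mem_erase] at h
    exact h.2.1 (congrArg Sigma.fst h')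
  · rintro ⟨v, w⟩ h
    simp only [Finset.mem_sigma, Finset.mem_erase] at h ⊢
    exact ⟨h.2.2, h.2.1.symm, h.1⟩
  · intros
    rfl

section Cone

variable {V W M : Type*} [DecidableEq V] [DecidableEq W] [AddCommGroup M]
  (i : W ↪ V) {a : V}

theorem sum_erase_map (f : Finset V → M) (τ : Finset W) :
    ∑ w ∈ τ.map i, f ((τ.map i).erase w) = ∑ w ∈ τ, f ((τ.erase w).map i) := by
  rw [Finset.sum_map]
  exact Finset.sum_congr rfl fun w _ => by rw [Finset.map_erase]

/-- The facets of a cone: the base, and the cones over the facets of the base. -/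
theorem sum_erase_cone (ha : ∀ w, i w ≠ a) (f : Finset V → M) (τ : Finset W) :
    ∑ w ∈ insert a (τ.map i), f ((insert a (τ.map i)).erase w) =
      f (τ.map i) + ∑ w ∈ τ, f (insert a ((τ.erase w).map i)) := by
  have haτ : a ∉ τ.map i := by
    rw [Finset.mem_map]
    rintro ⟨w, -, h⟩
    exact ha w h
  rw [Finset.sum_insert haτ, Finset.erase_insert haτ, Finset.sum_map]
  congr 1
  refine Finset.sum_congr rfl fun w _ => ?_
  rw [Finset.map_erase, Finset.erase_insert_of_ne (ha w).symm]

/-- The boundary of the cone over the boundary of `σ` is the boundary of `σ`. -/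
theorem sum_sum_erase_cone [Module (ZMod 2) M] (ha : ∀ w, i w ≠ a) (f : Finset V → M)
    (σ : Finset W) :
    ∑ v ∈ σ, ∑ w ∈ insert a ((σ.erase v).map i), f ((insert a ((σ.erase v).map i)).erase w) =
      ∑ v ∈ σ, f ((σ.erase v).map i) := by
  simp only [sum_erase_cone i ha, Finset.sum_add_distrib]
  rw [sum_sum_erase_eq_zero σ (fun v w => f (insert a (((σ.erase v).erase w).map i)))
    fun v w => by rw [Finset.erase_right_comm], add_zero]

end Cone

variable {X : Type v} [TopologicalSpace X] {ι : Type w} {V : Type*} [DecidableEq V]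

/-- `g` describes a chain map to `X` on the `k`-skeleton of the full simplex with vertex set `V`,
sending vertices to single points, and constrained by `(F, Φ)`. Here `g n σ` is the image of the
simplex `σ`; its value matters only if `σ` has exactly `n + 1 ≤ k + 1` vertices. -/
structure IsConstrainedSkeleton (F : Set (Set X)) (p : ι → X) (k : ℕ)
    (g : ∀ n : ℕ, Finset V → SingularChain X n) (Φ : Finset V → Set ι) : Prop where
  vertex : ∀ v, ∃ x, g 0 {v} = Finsupp.single (pointSimplex x) 1
  boundary : ∀ n < k, ∀ σ : Finset V, #σ = n + 2 →
    singularBoundary X n (g (n + 1) σ) = ∑ v ∈ σ, g n (σ.erase v)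
  empty : Φ ∅ = ∅
  inter : ∀ σ τ : Finset V, #σ ≤ k + 1 → #τ ≤ k + 1 → Φ (σ ∩ τ) = Φ σ ∩ Φ τ
  support : ∀ n ≤ k, ∀ σ : Finset V, #σ = n + 1 →
    g n σ ∈ chainsIn (relConvexHull F (p '' Φ σ)) n

/-- The union of the index sets assigned to the simplices of the `k`-skeleton spanned by `B`. -/
def skeletonIndices (Φ : Finset V → Set ι) (k : ℕ) (B : Finset V) : Set ι :=
  {x | ∃ τ ⊆ B, #τ ≤ k + 1 ∧ x ∈ Φ τ}

theorem subset_skeletonIndices {V : Type*} {Φ : Finset V → Set ι} {k : ℕ} {σ B : Finset V}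
    (hB : σ ⊆ B) (hσ : #σ ≤ k + 1) : Φ σ ⊆ skeletonIndices Φ k B :=
  fun _ hx => ⟨σ, hB, hσ, hx⟩

/-- The image of the boundary of a simplex `σ`. -/
noncomputable def boundaryImage {n : ℕ} (g : Finset V → SingularChain X n) (σ : Finset V) :
    SingularChain X n :=
  ∑ v ∈ σ, g (σ.erase v)

theorem sum_boundaryImage_erase {n : ℕ} (g : Finset V → SingularChain X n) (ρ : Finset V) :
    ∑ x ∈ ρ, boundaryImage g (ρ.erase x) = 0 :=
  sum_sum_erase_eq_zero ρ (fun v w => g ((ρ.erase v).erase w))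
    fun v w => by rw [Finset.erase_right_comm]

/-- If a functional takes the same value `h` on the images of the boundaries of all
`(k + 1)`-simplices in a set with more than `k + 2` vertices, then `(k + 3) • h = 0`, because the
boundaries of the `k + 3` facets of a `(k + 2)`-simplex add up to zero. -/
theorem smul_eq_zero_of_homogeneous {k : ℕ}
    {g : Finset V → SingularChain X k} {E : Type*} [AddCommGroup E] [Module (ZMod 2) E]
    {φ : SingularChain X k →ₗ[ZMod 2] E} {h : E} {M : Finset V} (hM : k + 3 ≤ #M)
    (hφ : ∀ ρ ⊆ M, #ρ = k + 2 → φ (boundaryImage g ρ) = h) : (k + 3) • h = 0 := by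
  obtain ⟨ρ, hρ, hc⟩ := Finset.exists_subset_card_eq hM
  have h1 := congrArg φ (sum_boundaryImage_erase g ρ)
  rw [map_sum, map_zero, Finset.sum_congr rfl (g := fun _ => h), Finset.sum_const, hc] at h1
  · exact h1
  · intro x hx
    exact hφ _ ((Finset.erase_subset _ _).trans hρ) (by rw [Finset.card_erase_of_mem hx, hc]; rfl)

namespace IsConstrainedSkeleton

variable {F : Set (Set X)} {p : ι → X} {k : ℕ} {g : ∀ n : ℕ, Finset V → SingularChain X n}
  {Φ : Finset V → Set ι}

theorem skeletonIndices_inter (hg : IsConstrainedSkeleton F p k g Φ)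
    (A B : Finset V) :
    skeletonIndices Φ k (A ∩ B) = skeletonIndices Φ k A ∩ skeletonIndices Φ k B := by
  ext x
  constructor
  · rintro ⟨τ, hτ, hc, hx⟩
    exact ⟨⟨τ, hτ.trans Finset.inter_subset_left, hc, hx⟩,
      ⟨τ, hτ.trans Finset.inter_subset_right, hc, hx⟩⟩
  · rintro ⟨⟨τ, hτ, hc, hx⟩, ⟨τ', hτ', hc', hx'⟩⟩
    refine ⟨τ ∩ τ', Finset.inter_subset_inter hτ hτ',
      (Finset.card_le_card Finset.inter_subset_left).trans hc, ?_⟩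
    rw [hg.inter τ τ' hc hc']
    exact ⟨hx, hx'⟩

theorem skeletonIndices_empty (hg : IsConstrainedSkeleton F p k g Φ) :
    skeletonIndices Φ k ∅ = ∅ := by
  refine Set.eq_empty_iff_forall_notMem.2 ?_
  rintro x ⟨τ, hτ, -, hx⟩
  rw [Finset.subset_empty.1 hτ, hg.empty] at hx
  exact hx

theorem mem_chainsIn_skeletonIndices (hg : IsConstrainedSkeleton F p k g Φ)
    {n : ℕ} (hn : n ≤ k) {σ B : Finset V} (hσ : #σ = n + 1) (hB : σ ⊆ B) :
    g n σ ∈ chainsIn (relConvexHull F (p '' skeletonIndices Φ k B)) n :=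
  chainsIn_mono (relConvexHull_mono F (Set.image_mono (subset_skeletonIndices hB (by omega)))) n
    (hg.support n hn σ hσ)

theorem boundaryImage_mem_chainsIn (hg : IsConstrainedSkeleton F p k g Φ)
    {ρ B : Finset V} (hρ : #ρ = k + 2) (hB : ρ ⊆ B) :
    boundaryImage (g k) ρ ∈ chainsIn (relConvexHull F (p '' skeletonIndices Φ k B)) k :=
  Submodule.sum_mem _ fun v hv => hg.mem_chainsIn_skeletonIndices le_rfl
    (by rw [Finset.card_erase_of_mem hv, hρ]; rfl) ((Finset.erase_subset _ _).trans hB)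

theorem boundaryImage_mem_reducedCycles (hg : IsConstrainedSkeleton F p k g Φ)
    {ρ : Finset V} (hρ : #ρ = k + 2) :
    boundaryImage (g k) ρ ∈ reducedCycles X k := by
  cases k with
  | zero =>
    change singularAugmentation X _ = 0
    rw [boundaryImage, map_sum, Finset.sum_congr rfl (g := fun _ => (1 : ZMod 2))]
    · rw [Finset.sum_const, hρ]
      rfl
    · intro v hv
      obtain ⟨w, hw⟩ := Finset.card_eq_one.1
        (show #(ρ.erase v) = 1 by rw [Finset.card_erase_of_mem hv, hρ])
      obtain ⟨x, hx⟩ := hg.vertex w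
      rw [hw, hx]
      simp [singularAugmentation]
  | succ k =>
    change singularBoundary X k _ = 0
    rw [boundaryImage, map_sum, Finset.sum_congr rfl fun v hv => hg.boundary k (Nat.lt_succ_self k)
      (ρ.erase v) (by rw [Finset.card_erase_of_mem hv, hρ]; rfl)]
    exact sum_boundaryImage_erase (g k) ρ

end IsConstrainedSkeleton

/-- The image of `σ` after replacing it by the cone, with an apex `a σ`, over its boundary. -/
noncomputable def coneImage {W : Type*} [DecidableEq W] {n : ℕ} (g : Finset V → SingularChain X n)
    (i : W ↪ V) (a : Finset W → V) (σ : Finset W) : SingularChain X n :=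
  ∑ v ∈ σ, g (insert (a σ) ((σ.erase v).map i))

section Step

variable {W : Type*} [DecidableEq W] {i : W ↪ V} {a : Finset W → V}

theorem boundaryImage_coneImage {n : ℕ} (g : Finset V → SingularChain X n)
    (hia : ∀ w τ, i w ≠ a τ) (σ : Finset W) :
    boundaryImage (coneImage g i a) σ = boundaryImage g (σ.map i) +
      ∑ x ∈ σ, boundaryImage g (insert (a (σ.erase x)) ((σ.erase x).map i)) := by
  have h : ∀ x, boundaryImage g (insert (a (σ.erase x)) ((σ.erase x).map i)) =
      g ((σ.erase x).map i) + coneImage g i a (σ.erase x) :=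
    fun x => sum_erase_cone i (fun w => hia w _) g (σ.erase x)
  rw [Finset.sum_congr rfl fun x _ => h x, Finset.sum_add_distrib, ← add_assoc, boundaryImage,
    boundaryImage, sum_erase_map, ZModModule.add_self, zero_add]

/-- The inductive step. The `k`-simplices of the new complex are sent to cones, and its
`(k + 1)`-simplices to given fillings. -/
theorem IsConstrainedSkeleton.extend {F : Set (Set X)} {p : ι → X} {k : ℕ}
    {g : ∀ n : ℕ, Finset V → SingularChain X n} {Φ : Finset V → Set ι}
    (hg : IsConstrainedSkeleton F p k g Φ) (hia : ∀ w τ, i w ≠ a τ)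
    (A : Finset W → Finset V) (hA0 : A ∅ = ∅)
    (hA : ∀ σ τ, #σ ≤ k + 2 → #τ ≤ k + 2 → A (σ ∩ τ) = A σ ∩ A τ)
    (hAi : ∀ σ, #σ ≤ k + 1 → σ.map i ⊆ A σ) (hAa : ∀ σ, #σ = k + 1 → a σ ∈ A σ)
    (hfill : ∀ σ, #σ = k + 2 → ∃ c ∈
      chainsIn (relConvexHull F (p '' skeletonIndices Φ k (A σ))) (k + 1),
        singularBoundary X k c = boundaryImage (coneImage (g k) i a) σ) :
    ∃ g' : ∀ n : ℕ, Finset W → SingularChain X n,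
      IsConstrainedSkeleton F p (k + 1) g' fun σ => skeletonIndices Φ k (A σ) := by
  have hfill' : ∀ σ, ∃ c, #σ = k + 2 →
      c ∈ chainsIn (relConvexHull F (p '' skeletonIndices Φ k (A σ))) (k + 1) ∧
        singularBoundary X k c = boundaryImage (coneImage (g k) i a) σ := by
    intro σ
    by_cases h : #σ = k + 2
    · obtain ⟨c, h1, h2⟩ := hfill σ h
      exact ⟨c, fun _ => ⟨h1, h2⟩⟩
    · exact ⟨0, fun h' => absurd h' h⟩
  choose fill hfill using hfill'
  let g' : ∀ n : ℕ, Finset W → SingularChain X n := Function.update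
    (fun n σ => if n = k then coneImage (g n) i a σ else g n (σ.map i)) (k + 1) fill
  have hlt : ∀ n < k, ∀ σ, g' n σ = g n (σ.map i) := by
    intro n hn σ
    simp only [g']
    rw [Function.update_of_ne (by omega), if_neg (by omega)]
  have hk : ∀ σ, g' k σ = coneImage (g k) i a σ := by
    intro σ
    simp only [g']
    rw [Function.update_of_ne (by omega), if_pos rfl]
  have hk1 : g' (k + 1) = fill := Function.update_self _ _ _
  refine ⟨g', ?_, ?_, ?_, ?_, ?_⟩
  · intro v
    rcases Nat.eq_zero_or_pos k with rfl | h0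
    · obtain ⟨x, hx⟩ := hg.vertex (a {v})
      exact ⟨x, by simpa [hk, coneImage] using hx⟩
    · obtain ⟨x, hx⟩ := hg.vertex (i v)
      exact ⟨x, by simpa [hlt 0 h0] using hx⟩
  · intro n hn σ hσ
    rcases (Nat.lt_succ_iff.1 hn).lt_or_eq with h | rfl
    · rcases (Nat.succ_le_of_lt h).lt_or_eq with h' | rfl
      · rw [hlt _ h', hg.boundary n h _ (by rw [Finset.card_map, hσ]), sum_erase_map]
        exact Finset.sum_congr rfl fun v _ => (hlt n h _).symm
      · rw [hk, coneImage, map_sum, Finset.sum_congr rfl fun v _ => (hlt n h _)]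
        rw [← sum_sum_erase_cone i (fun w => hia w σ) (g n) σ]
        refine Finset.sum_congr rfl fun v hv => hg.boundary n h _ ?_
        rw [Finset.card_insert_of_notMem, Finset.card_map, Finset.card_erase_of_mem hv, hσ]
        · rfl
        · rw [Finset.mem_map]
          rintro ⟨w, -, hw⟩
          exact hia w σ hw
    · rw [hk1, (hfill σ hσ).2]
      exact Finset.sum_congr rfl fun v _ => (hk _).symm
  · rw [hA0, hg.skeletonIndices_empty]
  · intro σ τ hσ hτ
    rw [hA σ τ hσ hτ, hg.skeletonIndices_inter]
  · intro n hn σ hσ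
    rcases hn.lt_or_eq with h | rfl
    · rcases (Nat.lt_succ_iff.1 h).lt_or_eq with h' | rfl
      · rw [hlt n h']
        exact hg.mem_chainsIn_skeletonIndices h'.le (by rw [Finset.card_map, hσ])
          (hAi σ (by omega))
      · rw [hk]
        refine Submodule.sum_mem _ fun v hv => hg.mem_chainsIn_skeletonIndices le_rfl ?_ ?_
        · rw [Finset.card_insert_of_notMem, Finset.card_map, Finset.card_erase_of_mem hv, hσ]
          · rfl
          · rw [Finset.mem_map]
            rintro ⟨w, -, hw⟩
            exact hia w σ hw
        · exact Finset.insert_subset (hAa σ hσ)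
            ((Finset.map_subset_map.2 (Finset.erase_subset _ _)).trans (hAi σ hσ.le))
    · rw [hk1]
      exact (hfill σ hσ).1

end Step

/-! ### Existence of constrained chain maps on skeleta -/

theorem exists_embedding_of_le_card {ι : Type*} {n : ℕ} (h : (n : ℕ∞) ≤ ENat.card ι) :
    Nonempty (Fin n ↪ ι) := by
  cases finite_or_infinite ι with
  | inl _ =>
    rw [ENat.card_eq_coe_natCard, Nat.cast_le] at h
    exact ⟨(Fin.castLEEmb h).trans (Finite.equivFin ι).symm.toEmbedding⟩
  | inr _ => exact ⟨Fin.valEmbedding.trans (Infinite.natEmbedding ι)⟩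

theorem isConstrainedSkeleton_zero {X : Type v} [TopologicalSpace X] {ι : Type w} {V : Type*}
    [DecidableEq V] (F : Set (Set X)) (p : ι → X) (e : V ↪ ι) :
    IsConstrainedSkeleton F p 0
      (Function.update (fun _ _ => 0) 0 fun σ => ∑ v ∈ σ, Finsupp.single (pointSimplex (p (e v))) 1)
      (fun σ : Finset V => e '' σ) where
  vertex v := ⟨p (e v), by simp⟩
  boundary n hn := absurd hn (Nat.not_lt_zero n)
  empty := by simp
  inter σ τ _ _ := by rw [Finset.coe_inter, Set.image_inter e.injective]
  support n hn σ hσ := by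
    obtain rfl := Nat.le_zero.1 hn
    obtain ⟨v, rfl⟩ := Finset.card_eq_one.1 hσ
    simp only [Function.update_self, Finset.sum_singleton, Finset.coe_singleton,
      Set.image_singleton]
    refine single_mem_chainsIn ?_
    rintro _ ⟨y, rfl⟩
    exact subset_relConvexHull F _ rfl

/-- Given enough points, there is a constrained chain map on the `k`-skeleton of the full simplex
with `N` vertices. -/
theorem exists_isConstrainedSkeleton (b k N : ℕ) :
    ∃ r : ℕ, ∀ (X : Type v) [TopologicalSpace X] (F : Set (Set X)) (ι : Type w) (p : ι → X),
      (∀ G ⊆ F, ∀ i < k, reducedBetti (⋂₀ G) i ≤ (b : ℕ∞)) → (r : ℕ∞) ≤ ENat.card ι →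
        ∃ (g : ∀ n : ℕ, Finset (Fin N) → SingularChain X n) (Φ : Finset (Fin N) → Set ι),
          IsConstrainedSkeleton F p k g Φ := by
  classical
  induction k generalizing N with
  | zero =>
    refine ⟨N, fun X _ F ι p _ hr => ?_⟩
    obtain ⟨e⟩ := exists_embedding_of_le_card hr
    exact ⟨_, _, isConstrainedSkeleton_zero F p e⟩
  | succ k ih =>
    -- A simplex with `k + 2` vertices has `2 * (k + 2)` labels: its vertices and its facets.
    obtain ⟨t, ht⟩ :=
      exists_homogeneous.{0} (κ := Fin b → ZMod 2) (k + 2) (2 * (k + 2))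
    -- Each new vertex `v` gets a label `inl v`, and each new `k`-simplex `τ` a label `inr τ` for
    -- the apex of the cone that replaces it; `C σ` collects the labels belonging to `σ`.
    let C : Finset (Fin N) → Finset (Fin N ⊕ Finset (Fin N)) :=
      fun σ => σ.disjSum (σ.powersetCard (k + 1))
    have hC : ∀ σ τ, C (σ ∩ τ) = C σ ∩ C τ := by
      intro σ τ
      ext (x | x)
      · simp [C]
      · simp only [C, Finset.inr_mem_disjSum, Finset.mem_inter, Finset.mem_powersetCard,
          Finset.subset_inter_iff]
        tauto
    have hCcard : ∀ σ, #σ = k + 2 → #(C σ) = 2 * (k + 2) := by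
      intro σ hσ
      rw [Finset.card_disjSum, Finset.card_powersetCard, hσ, Nat.choose_succ_self_right]
      omega
    obtain ⟨N', hN'⟩ := exists_placement (β := {σ : Finset (Fin N) // #σ = k + 2})
      (2 * (k + 2)) t (fun σ => C σ.1) fun σ => hCcard σ.1 σ.2
    obtain ⟨r, hr⟩ := ih N'
    refine ⟨r, fun X _ F ι p hF hcard => ?_⟩
    obtain ⟨g, Φ, hg⟩ := hr X F ι p (fun G hG i hi => hF G hG i (hi.trans k.lt_succ_self)) hcard
    -- `M T` is a set of vertices in `T` such that the boundaries of all `(k + 1)`-simplices in it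
    -- have the same class in the hull belonging to `T`.
    have hM : ∀ T : Finset (Fin N'), ∃ (M : Finset (Fin N'))
        (φ : SingularChain X k →ₗ[ZMod 2] (Fin b → ZMod 2)) (h : Fin b → ZMod 2), #T = t →
        (M ⊆ T ∧ #M = 2 * (k + 2)) ∧
        (∀ ρ ⊆ M, #ρ = k + 2 → φ (boundaryImage (g k) ρ) = h) ∧
        ∀ z ∈ chainsIn (relConvexHull F (p '' skeletonIndices Φ k T)) k,
          z ∈ reducedCycles X k → φ z = 0 →
          ∃ c ∈ chainsIn (relConvexHull F (p '' skeletonIndices Φ k T)) (k + 1),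
            singularBoundary X k c = z := by
      intro T
      by_cases hT : #T = t
      · obtain ⟨φ, hφ⟩ := exists_detecting_map (hF
          {A ∈ F | p '' skeletonIndices Φ k T ⊆ A} (fun _ h => h.1) k k.lt_succ_self)
        obtain ⟨M, hMT, hMc, h, hh⟩ := ht T (fun ρ => φ (boundaryImage (g k) ρ)) hT.ge
        exact ⟨M, φ, h, fun _ => ⟨⟨hMT, hMc⟩, hh, hφ⟩⟩
      · exact ⟨∅, 0, 0, fun h => absurd h hT⟩
    choose M φ h hM using hM
    obtain ⟨u, T, hTc, hMT, hTu, hTT⟩ := hN' M fun T hT => (hM T hT).1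
    let i : Fin N ↪ Fin N' := Function.Embedding.inl.trans u
    let a : Finset (Fin N) → Fin N' := fun τ => u (Sum.inr τ)
    have hia : ∀ w τ, i w ≠ a τ := fun w τ h => by simpa using u.injective h
    have hiC : ∀ σ, σ.map i ⊆ (C σ).map u := by
      intro σ x hx
      obtain ⟨v, hv, rfl⟩ := Finset.mem_map.1 hx
      exact Finset.mem_map.2 ⟨Sum.inl v, Finset.inl_mem_disjSum.2 hv, rfl⟩
    have haC : ∀ σ τ, #τ = k + 1 → τ ⊆ σ → a τ ∈ (C σ).map u := fun σ τ hτ hτσ =>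
      Finset.mem_map.2 ⟨Sum.inr τ,
        Finset.inr_mem_disjSum.2 (Finset.mem_powersetCard.2 ⟨hτσ, hτ⟩), rfl⟩
    -- The vertices available to `σ`. Only the top-dimensional simplices need more than their
    -- labels, in order that a cycle can be filled.
    let A : Finset (Fin N) → Finset (Fin N') :=
      fun σ => if h : #σ = k + 2 then T ⟨σ, h⟩ else (C σ).map u
    have hA1 : ∀ σ (h : #σ = k + 2), A σ = T ⟨σ, h⟩ := fun σ h => dif_pos h
    have hA2 : ∀ σ, #σ ≠ k + 2 → A σ = (C σ).map u := fun σ h => dif_neg h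
    have hTC : ∀ σ (h : #σ = k + 2) (B : Finset _),
        T ⟨σ, h⟩ ∩ B.map u = (C σ ∩ B).map u := by
      intro σ hσ B
      ext x
      simp only [Finset.mem_inter, Finset.mem_map]
      constructor
      · rintro ⟨hx, y, hy, rfl⟩
        exact ⟨y, ⟨(hTu _ _).1 hx, hy⟩, rfl⟩
      · rintro ⟨y, ⟨hy, hy'⟩, rfl⟩
        exact ⟨(hTu _ _).2 hy, y, hy', rfl⟩
    have hcard_inter : ∀ σ τ : Finset (Fin N), #σ ≤ k + 2 → #τ ≤ k + 2 → σ ≠ τ →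
        #(σ ∩ τ) ≠ k + 2 := by
      intro σ τ hσ hτ hne heq
      have h1 := Finset.eq_of_subset_of_card_le (Finset.inter_subset_left (s₁ := σ) (s₂ := τ))
        (by omega)
      have h2 := Finset.eq_of_subset_of_card_le (Finset.inter_subset_right (s₁ := σ) (s₂ := τ))
        (by omega)
      exact hne (h1.symm.trans h2)
    refine ⟨_, _, (hg.extend hia A ?_ ?_ ?_ ?_ ?_).choose_spec⟩
    · rw [hA2 ∅ (by simp)]
      simp [C, Finset.powersetCard_eq_empty]
    · intro σ τ hσ hτ
      by_cases hne : σ = τ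
      · simp [hne]
      rw [hA2 _ (hcard_inter σ τ hσ hτ hne), hC]
      by_cases h1 : #σ = k + 2
      · by_cases h2 : #τ = k + 2
        · rw [hA1 σ h1, hA1 τ h2]
          ext x
          constructor
          · intro hx
            obtain ⟨y, hy, rfl⟩ := Finset.mem_map.1 hx
            rw [Finset.mem_inter] at hy ⊢
            exact ⟨(hTu _ _).2 hy.1, (hTu _ _).2 hy.2⟩
          · intro hx
            rw [Finset.mem_inter] at hx
            obtain ⟨y, rfl⟩ := hTT ⟨σ, h1⟩ ⟨τ, h2⟩ (fun h => hne (congrArg Subtype.val h)) x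
              hx.1 hx.2
            exact Finset.mem_map_of_mem u
              (Finset.mem_inter.2 ⟨(hTu _ _).1 hx.1, (hTu _ _).1 hx.2⟩)
        · rw [hA1 σ h1, hA2 τ h2, hTC]
      · by_cases h2 : #τ = k + 2
        · rw [hA1 τ h2, hA2 σ h1, Finset.inter_comm (Finset.map _ _), hTC, Finset.inter_comm]
        · rw [hA2 τ h2, hA2 σ h1, Finset.map_inter]
    · intro σ hσ
      rw [hA2 σ (by omega)]
      exact hiC σ
    · intro σ hσ
      rw [hA2 σ (by omega)]
      exact haC σ σ hσ subset_rfl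
    · intro σ hσ
      rw [hA1 σ hσ]
      set T₀ := T ⟨σ, hσ⟩ with hT₀
      obtain ⟨⟨hMT₀, hMc⟩, hh, hdet⟩ := hM T₀ (hTc _)
      have hMC : M T₀ = (C σ).map u := hMT ⟨σ, hσ⟩
      have hρ₁ : σ.map i ⊆ M T₀ := hMC ▸ hiC σ
      have hρ₂ : ∀ x ∈ σ, insert (a (σ.erase x)) ((σ.erase x).map i) ⊆ M T₀ := by
        intro x hx
        refine Finset.insert_subset (hMC ▸ haC σ _ ?_ (Finset.erase_subset _ _))
          ((Finset.map_subset_map.2 (Finset.erase_subset _ _)).trans hρ₁)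
        rw [Finset.card_erase_of_mem hx, hσ]
        rfl
      have hc₁ : #(σ.map i) = k + 2 := by rw [Finset.card_map, hσ]
      have hc₂ : ∀ x ∈ σ, #(insert (a (σ.erase x)) ((σ.erase x).map i)) = k + 2 := by
        intro x hx
        rw [Finset.card_insert_of_notMem, Finset.card_map, Finset.card_erase_of_mem hx, hσ]
        · rfl
        · rw [Finset.mem_map]
          rintro ⟨w, -, hw⟩
          exact hia w _ hw
      apply hdet
      · rw [boundaryImage_coneImage _ hia]
        exact add_mem (hg.boundaryImage_mem_chainsIn hc₁ (hρ₁.trans hMT₀))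
          (Submodule.sum_mem _ fun x hx =>
            hg.boundaryImage_mem_chainsIn (hc₂ x hx) ((hρ₂ x hx).trans hMT₀))
      · rw [boundaryImage_coneImage _ hia]
        exact add_mem (hg.boundaryImage_mem_reducedCycles hc₁)
          (Submodule.sum_mem _ fun x hx => hg.boundaryImage_mem_reducedCycles (hc₂ x hx))
      · rw [boundaryImage_coneImage _ hia, map_add, map_sum, hh _ hρ₁ hc₁,
          Finset.sum_congr rfl fun x hx => hh _ (hρ₂ x hx) (hc₂ x hx), Finset.sum_const, hσ,
          ← succ_nsmul']
        exact smul_eq_zero_of_homogeneous (by omega) hh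

/-! ### From skeleta of a simplex to simplicial complexes -/

theorem odd_card_support_single {X : Type v} [TopologicalSpace X] (x : X) :
    Odd (Finsupp.single (pointSimplex x) (1 : ZMod 2)).support.card := by
  classical
  simp [Finsupp.support_single]

theorem ChainMap.onSimplex_eq {V : Type u} {K : PreAbstractSimplicialComplex V} {X : Type v}
    [TopologicalSpace X] {γ : ChainMap K X} {n : ℕ} {h : Simplex K n → SingularChain X n}
    (hγ : γ.app n = Finsupp.linearCombination (ZMod 2) h) (σ : Simplex K n) :
    γ.onSimplex σ = h σ := by
  rw [ChainMap.onSimplex, hγ, Finsupp.linearCombination_single, one_smul]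

open Classical in
/-- A constrained chain map on a skeleton restricts to every complex of the same dimension. -/
theorem IsConstrainedSkeleton.exists_chainMap {V : Type u} {K : PreAbstractSimplicialComplex V}
    {X : Type v} [TopologicalSpace X] {ι : Type w} {F : Set (Set X)} {p : ι → X} {d N : ℕ}
    {g : ∀ n : ℕ, Finset (Fin N) → SingularChain X n} {Φ : Finset (Fin N) → Set ι}
    (hg : IsConstrainedSkeleton F p d g Φ) (hd : ∀ σ ∈ K.faces, #σ ≤ d + 1)
    {e : V → Fin N} {W : Finset V} (he : Set.InjOn e W) (hW : ∀ σ ∈ K.faces, σ ⊆ W) :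
    ∃ γ : ChainMap K X,
      (∀ v : Simplex K 0, ∃ x, γ.onSimplex v = Finsupp.single (pointSimplex x) 1) ∧
        γ.IsConstrainedBy F p := by
  have hinj : ∀ σ ∈ K.faces, Set.InjOn e σ := fun σ hσ =>
    he.mono (Finset.coe_subset.2 (hW σ hσ))
  have hcard : ∀ σ ∈ K.faces, #(σ.image e) = #σ := fun σ hσ =>
    Finset.card_image_of_injOn (hinj σ hσ)
  let γ : ChainMap K X :=
    { app := fun n => Finsupp.linearCombination (ZMod 2) fun σ : Simplex K n => g n (σ.1.image e)
      comm := by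
        intro n c
        induction c using Finsupp.induction_linear with
        | zero => simp
        | add c c' hc hc' => simp only [map_add, hc, hc']
        | single σ a =>
          have hσ := hd σ.1 σ.2.1
          rw [σ.2.2] at hσ
          rw [Finsupp.linearCombination_single, simplicialBoundary,
            Finsupp.linearCombination_single, map_smul, map_smul, map_sum,
            hg.boundary n (by omega) _ (by rw [hcard σ.1 σ.2.1, σ.2.2]),
            Finset.sum_image (hinj σ.1 σ.2.1), ← Finset.sum_attach]
          congr 1
          refine Finset.sum_congr rfl fun v _ => ?_
          rw [Finsupp.linearCombination_single, one_smul]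
          congr 1
          ext y
          simp only [Simplex.facet, Finset.mem_erase, Finset.mem_image]
          constructor
          · rintro ⟨hy, w, hw, rfl⟩
            exact ⟨w, ⟨fun h => hy (h ▸ rfl), hw⟩, rfl⟩
          · rintro ⟨w, ⟨hwv, hw⟩, rfl⟩
            exact ⟨fun h => hwv (hinj σ.1 σ.2.1 hw v.2 h), w, hw, rfl⟩ }
  have hγ : ∀ {n : ℕ} (σ : Simplex K n), γ.onSimplex σ = g n (σ.1.image e) :=
    fun {n} σ => ChainMap.onSimplex_eq (γ := γ) (h := fun σ => g n (σ.1.image e)) rfl σ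
  refine ⟨γ, fun v => ?_, fun σ => Φ (σ.image e), by simp [hg.empty], fun σ hσ τ hτ => ?_,
    fun n σ => ?_⟩
  · obtain ⟨w, hw⟩ := Finset.card_eq_one.1 ((hcard v.1 v.2.1).trans v.2.2)
    rw [hγ, hw]
    exact hg.vertex w
  · change Φ ((σ ∩ τ).image e) = _
    rw [Finset.image_inter_of_injOn _ _ (he.mono (Set.union_subset
      (Finset.coe_subset.2 (hW σ hσ)) (Finset.coe_subset.2 (hW τ hτ))))]
    exact hg.inter _ _ ((hcard σ hσ).trans_le (hd σ hσ)) ((hcard τ hτ).trans_le (hd τ hτ))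
  · have hσ := hd σ.1 σ.2.1
    rw [σ.2.2] at hσ
    rw [hγ, ← mem_chainsIn]
    exact hg.support n (by omega) _ ((hcard σ.1 σ.2.1).trans σ.2.2)

/-! ### Complexes of dimension at most one -/

section Realization

variable {V : Type u} {K : PreAbstractSimplicialComplex V} {X : Type v} [TopologicalSpace X]

/-- The points of `|K|`, in barycentric coordinates, that lie in the geometric simplex `|σ|`. -/
def geometricSimplex (σ : Finset V) : Set (V → ℝ) :=
  {y | (∀ v, 0 ≤ y v) ∧ (∀ v, v ∉ σ → y v = 0) ∧ ∑ v ∈ σ, y v = 1}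

theorem isClosed_geometricSimplex (σ : Finset V) : IsClosed (geometricSimplex σ) := by
  have h1 : IsClosed {y : V → ℝ | ∀ v, 0 ≤ y v} := by
    simp only [Set.ofPred_forall]
    exact isClosed_iInter fun v => isClosed_le continuous_const (continuous_apply v)
  have h2 : IsClosed {y : V → ℝ | ∀ v, v ∉ σ → y v = 0} := by
    simp only [Set.ofPred_forall]
    exact isClosed_iInter fun v => isClosed_iInter fun _ =>
      isClosed_eq (continuous_apply v) continuous_const
  have h3 : IsClosed {y : V → ℝ | ∑ v ∈ σ, y v = 1} :=
    isClosed_eq (continuous_finsetSum _ fun v _ => continuous_apply v) continuous_const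
  exact h1.inter (h2.inter h3)

/-- Distinct vertices and edges of a graph meet at most in a vertex. -/
theorem exists_vertex_of_mem_geometricSimplex {σ τ : Finset V} (hσ : #σ ≤ 2) (hτ : #τ ≤ 2)
    (hne : σ ≠ τ) {y : V → ℝ} (hyσ : y ∈ geometricSimplex σ) (hyτ : y ∈ geometricSimplex τ) :
    ∃ v ∈ σ, v ∈ τ ∧ y v = 1 := by
  classical
  have hsum : ∑ v ∈ σ ∩ τ, y v = 1 := by
    rw [← hyσ.2.2]
    refine Finset.sum_subset Finset.inter_subset_left fun v hv hv' => hyτ.2.1 v fun h => ?_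
    exact hv' (Finset.mem_inter.2 ⟨hv, h⟩)
  have hc : #(σ ∩ τ) ≤ 1 := by
    by_contra hc
    have h1 := Finset.eq_of_subset_of_card_le (Finset.inter_subset_left (s₁ := σ) (s₂ := τ))
      (by omega)
    have h2 := Finset.eq_of_subset_of_card_le (Finset.inter_subset_right (s₁ := σ) (s₂ := τ))
      (by omega)
    exact hne (h1.symm.trans h2)
  have hc' : #(σ ∩ τ) = 1 := by
    refine le_antisymm hc (Finset.card_pos.2 (Finset.nonempty_iff_ne_empty.2 fun h => ?_))
    rw [h, Finset.sum_empty] at hsum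
    exact zero_ne_one hsum
  obtain ⟨v, hv⟩ := Finset.card_eq_one.1 hc'
  rw [hv, Finset.sum_singleton] at hsum
  have hmem := Finset.mem_inter.1 (hv ▸ Finset.mem_singleton_self v : v ∈ σ ∩ τ)
  exact ⟨v, hmem.1, hmem.2, hsum⟩

/-- A continuous map on a finite graph is obtained by joining the images of adjacent vertices by
paths. -/
theorem exists_continuousMap_of_joinedIn (hK : K.faces.Finite) (hd : ∀ σ ∈ K.faces, #σ ≤ 2)
    (x : V → X) (B : Finset V → Set X) (hx : ∀ v, {v} ∈ K.faces → x v ∈ B {v})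
    (hB : ∀ σ ∈ K.faces, #σ = 2 → ∀ u ∈ σ, ∀ v ∈ σ, JoinedIn (B σ) (x u) (x v)) :
    ∃ f : C(Realization K, X),
      (∀ (y : Realization K) (v : V), y.1 v = 1 → f y = x v) ∧
        ∀ σ ∈ K.faces, ∀ y : Realization K, y.1 ∈ geometricSimplex σ → f y ∈ B σ := by
  classical
  have hloc : ∀ σ : K.faces, ∃ h : (V → ℝ) → X, Continuous h ∧
      (∀ v ∈ σ.1, ∀ y ∈ geometricSimplex σ.1, y v = 1 → h y = x v) ∧ ∀ y, h y ∈ B σ.1 := by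
    rintro ⟨σ, hσ⟩
    have hpos : 0 < #σ := Finset.card_pos.2 (K.isRelLowerSet_faces hσ).1
    have h12 : #σ = 1 ∨ #σ = 2 := by have := hd σ hσ; omega
    rcases h12 with h | h
    · obtain ⟨u, rfl⟩ := Finset.card_eq_one.1 h
      refine ⟨fun _ => x u, continuous_const, fun v hv _ _ _ => ?_, fun _ => hx u hσ⟩
      rw [Finset.mem_singleton.1 hv]
    · obtain ⟨u, v, huv, rfl⟩ := Finset.card_eq_two.1 h
      have hj := hB _ hσ h u (by simp) v (by simp)
      refine ⟨fun y => hj.somePath.extend (y v),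
        hj.somePath.continuous_extend.comp (continuous_apply v), fun w hw y hy hyw => ?_,
        fun y => ?_⟩
      · rcases Finset.mem_insert.1 hw with rfl | hw
        · have := hy.2.2
          rw [Finset.sum_pair huv, hyw] at this
          simp [show y v = 0 by linarith]
        · rw [Finset.mem_singleton.1 hw] at hyw ⊢
          simp [hyw]
      · have : hj.somePath.extend (y v) ∈ Set.range hj.somePath := by
          rw [← Path.extend_range]
          exact ⟨_, rfl⟩
        obtain ⟨t, ht⟩ := this
        change hj.somePath.extend (y v) ∈ _
        rw [← ht]
        exact hj.somePath_mem t
  -- The local maps agree on overlaps, since these are vertices, and so they can be glued.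
  choose h hcont hvert hmem using hloc
  have hface : ∀ y : Realization K, ∃ σ : K.faces, y.1 ∈ geometricSimplex σ.1 := by
    rintro ⟨y, σ, hσ, hy⟩
    exact ⟨⟨σ, hσ⟩, hy⟩
  choose s hs using hface
  have hagree : ∀ (σ : K.faces) (y : Realization K), y.1 ∈ geometricSimplex σ.1 →
      h (s y) y.1 = h σ y.1 := by
    intro σ y hy
    by_cases hne : (s y).1 = σ.1
    · rw [Subtype.ext hne]
    · obtain ⟨v, hv, hv', hyv⟩ := exists_vertex_of_mem_geometricSimplex (hd _ (s y).2) (hd _ σ.2)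
        hne (hs y) hy
      rw [hvert _ v hv _ (hs y) hyv, hvert _ v hv' _ hy hyv]
  have : Finite K.faces := hK
  refine ⟨⟨fun y => h (s y) y.1, ?_⟩, fun y v hyv => ?_, fun σ hσ y hy => ?_⟩
  · refine (locallyFinite_of_finite fun σ : K.faces =>
      {y : Realization K | y.1 ∈ geometricSimplex σ.1}).continuous ?_ ?_ ?_
    · exact Set.eq_univ_of_forall fun y => Set.mem_iUnion.2 ⟨s y, hs y⟩
    · exact fun σ => (isClosed_geometricSimplex σ.1).preimage continuous_subtype_val
    · exact fun σ => ((hcont σ).comp continuous_subtype_val).continuousOn.congr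
        fun y hy => hagree σ y hy
  · refine hvert (s y) v ?_ _ (hs y) hyv
    by_contra hv
    exact zero_ne_one (((hs y).2.1 v hv).symm.trans hyv)
  · change h (s y) y.1 ∈ _
    rw [hagree ⟨σ, hσ⟩ y hy]
    exact hmem ⟨σ, hσ⟩ _

theorem characteristicMap_apply {n : ℕ} (e : Fin (n + 1) ↪ V) (he : Finset.univ.map e ∈ K.faces)
    (t : stdSimplex ℝ (Fin (n + 1))) (j : Fin (n + 1)) :
    (characteristicMap e he t).1 (e j) = t j := by
  simp [characteristicMap]

theorem characteristicMap_mem {n : ℕ} (e : Fin (n + 1) ↪ V) (he : Finset.univ.map e ∈ K.faces)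
    (t : stdSimplex ℝ (Fin (n + 1))) :
    (characteristicMap e he t).1 ∈ geometricSimplex (Finset.univ.map e) := by
  classical
  refine ⟨fun v => ?_, fun v hv => ?_, ?_⟩
  · change 0 ≤ ∑ i, if e i = v then t i else 0
    refine Finset.sum_nonneg fun i _ => ?_
    split_ifs
    · exact stdSimplex.zero_le t i
    · exact le_rfl
  · change (∑ i, if e i = v then t i else 0) = 0
    exact Finset.sum_eq_zero fun i _ =>
      if_neg fun h => hv (Finset.mem_map.2 ⟨i, Finset.mem_univ i, h⟩)
  · rw [Finset.sum_map]
    simp only [characteristicMap_apply]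
    exact stdSimplex.sum_eq_one t

theorem characteristicMap_congr {n : ℕ} {e e' : Fin (n + 1) ↪ V} (h : e = e')
    (he : Finset.univ.map e ∈ K.faces) (he' : Finset.univ.map e' ∈ K.faces) :
    characteristicMap e he = characteristicMap e' he' := by
  subst h
  rfl

theorem Simplex.map_orderEmbOfFin_mem [LinearOrder V] {n : ℕ} (σ : Simplex K n) :
    Finset.univ.map (σ.1.orderEmbOfFin σ.2.2).toEmbedding ∈ K.faces := by
  rw [Finset.map_orderEmbOfFin_univ]
  exact σ.2.1

/-- The singular simplex that a map `f : |K| → X` induces on a simplex of `K`. -/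
noncomputable def inducedSimplex [LinearOrder V] (f : C(Realization K, X)) {n : ℕ}
    (σ : Simplex K n) : SingularSimplex X n :=
  f.comp (characteristicMap _ σ.map_orderEmbOfFin_mem)

theorem inducedSimplex_zero [LinearOrder V] {f : C(Realization K, X)} {x : V → X}
    (hf : ∀ (y : Realization K) (v : V), y.1 v = 1 → f y = x v) (σ : Simplex K 0) {v : V}
    (hv : v ∈ σ.1) : inducedSimplex f σ = pointSimplex (x v) := by
  obtain ⟨w, hw⟩ := Finset.card_eq_one.1 σ.2.2
  ext t
  change f _ = x v
  refine hf _ v ?_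
  have h0 : (σ.1.orderEmbOfFin σ.2.2).toEmbedding 0 = v := by
    rw [hw, Finset.mem_singleton] at hv
    have h1 : ∀ y ∈ σ.1, y = w := fun y hy => Finset.mem_singleton.1 (hw ▸ hy)
    exact (h1 _ (σ.1.orderEmbOfFin_mem σ.2.2 0)).trans hv.symm
  rw [← h0, characteristicMap_apply]
  exact stdSimplex.eq_one_of_unique (X := Fin 1) t 0

theorem Simplex.eq_pair [DecidableEq V] (σ : Simplex K 1) {u v : V} (hu : u ∈ σ.1) (hv : v ∈ σ.1)
    (huv : u ≠ v) : σ.1 = {u, v} := by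
  refine (Finset.eq_of_subset_of_card_le ?_ ?_).symm
  · exact Finset.insert_subset hu (Finset.singleton_subset_iff.2 hv)
  · rw [σ.2.2, Finset.card_pair huv]

theorem simplicialBoundary_edge (σ : Simplex K 1) {u v : V} (hu : u ∈ σ.1) (hv : v ∈ σ.1)
    (huv : u ≠ v) : ∃ τ τ' : Simplex K 0, τ.1 = {u} ∧ τ'.1 = {v} ∧
      simplicialBoundary K 0 (Finsupp.single σ 1) = Finsupp.single τ 1 + Finsupp.single τ' 1 := by
  classical
  have hσ := σ.eq_pair hu hv huv
  refine ⟨σ.facet ⟨v, hv⟩, σ.facet ⟨u, hu⟩, ?_, ?_, ?_⟩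
  · change σ.1.erase v = {u}
    rw [hσ]
    grind
  · change σ.1.erase u = {v}
    rw [hσ]
    grind
  · rw [simplicialBoundary, Finsupp.linearCombination_single, one_smul]
    have : σ.1.attach = {⟨v, hv⟩, ⟨u, hu⟩} := by
      ext ⟨w, hw⟩
      have : w = u ∨ w = v := by simpa [hσ] using hw
      simpa using this.symm
    rw [this, Finset.sum_pair fun h => huv (congrArg Subtype.val h).symm]

theorem singularBoundary_inducedSimplex [LinearOrder V] {f : C(Realization K, X)} {x : V → X}
    (hf : ∀ (y : Realization K) (v : V), y.1 v = 1 → f y = x v) (σ : Simplex K 1) {u v : V}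
    (hu : u ∈ σ.1) (hv : v ∈ σ.1) (huv : u ≠ v) :
    singularBoundary X 0 (Finsupp.single (inducedSimplex f σ) 1) =
      Finsupp.single (pointSimplex (x u)) 1 + Finsupp.single (pointSimplex (x v)) 1 := by
  have hface : ∀ i : Fin 2, SingularSimplex.face (inducedSimplex f σ) i =
      pointSimplex (x (σ.1.orderEmbOfFin σ.2.2 (i.succAbove 0))) := by
    intro i
    ext t
    refine hf _ _ ((characteristicMap_apply _ _ _ _).trans ?_)
    change stdSimplex.map i.succAbove t (i.succAbove 0) = 1
    rw [stdSimplex.map_coe, FunOnFinite.linearMap_apply_apply, Finset.filter_true_of_mem]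
    · exact stdSimplex.sum_eq_one t
    · intro j _
      rw [Subsingleton.elim (α := Fin 1) j 0]
  have hb : ∑ i : Fin (0 + 2), Finsupp.single ((inducedSimplex f σ).face i) (1 : ZMod 2) =
      Finsupp.single ((inducedSimplex f σ).face 0) 1 +
        Finsupp.single ((inducedSimplex f σ).face 1) 1 := Fin.sum_univ_two _
  rw [singularBoundary, Finsupp.linearCombination_single, one_smul, hb, hface 0, hface 1]
  have hsum : ∑ w ∈ σ.1, Finsupp.single (pointSimplex (x w)) (1 : ZMod 2) =
      Finsupp.single (pointSimplex (x u)) 1 + Finsupp.single (pointSimplex (x v)) 1 := by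
    rw [σ.eq_pair hu hv huv, Finset.sum_pair huv]
  rw [← hsum, ← Finset.sum_coe_sort, ← (σ.1.orderIsoOfFin σ.2.2).toEquiv.sum_comp, add_comm]
  exact (Fin.sum_univ_two (fun i : Fin 2 =>
    Finsupp.single (pointSimplex (x (σ.1.orderEmbOfFin σ.2.2 i))) (1 : ZMod 2))).symm

end Realization

/-- In dimension at most one, the `1`-chains of a constrained chain map that sends vertices to
points can be replaced by paths. -/
theorem exists_isInducedBy {V : Type u} {K : PreAbstractSimplicialComplex V} {X : Type v}
    [TopologicalSpace X] [Nonempty X] {ι : Type w} {F : Set (Set X)} {p : ι → X}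
    (hK : K.faces.Finite) (hd : ∀ σ ∈ K.faces, #σ ≤ 2) {γ : ChainMap K X}
    (hγ : ∀ v : Simplex K 0, ∃ x, γ.onSimplex v = Finsupp.single (pointSimplex x) 1)
    (hc : γ.IsConstrainedBy F p) :
    ∃ f : C(Realization K, X), ∀ [LinearOrder V],
      ∃ γ : ChainMap K X, γ.IsInducedBy f ∧ γ.Nontrivial ∧ γ.IsConstrainedBy F p := by
  classical
  obtain ⟨Φ, h0, hΦ, hsupp⟩ := hc
  have hx : ∀ v, ∃ x, ∀ h : {v} ∈ K.faces, γ.onSimplex (n := 0) ⟨{v}, h, Finset.card_singleton v⟩ =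
      Finsupp.single (pointSimplex x) 1 := by
    intro v
    by_cases h : {v} ∈ K.faces
    · obtain ⟨x, hx⟩ := hγ ⟨{v}, h, Finset.card_singleton v⟩
      exact ⟨x, fun _ => hx⟩
    · exact ⟨Classical.arbitrary X, fun h' => absurd h' h⟩
  choose x hx using hx
  have hxmem : ∀ v, {v} ∈ K.faces → x v ∈ relConvexHull F (p '' Φ {v}) := by
    intro v hv
    have h1 := hsupp 0 ⟨{v}, hv, Finset.card_singleton v⟩
    rw [hx v hv] at h1
    refine h1 (Set.mem_iUnion₂.2 ⟨pointSimplex (x v), by simp, default, rfl⟩)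
  have hvert : ∀ σ ∈ K.faces, ∀ v ∈ σ, {v} ∈ K.faces := fun σ hσ v hv =>
    (K.isRelLowerSet_faces hσ).2 (Finset.singleton_subset_iff.2 hv) (Finset.singleton_nonempty v)
  have hmono : ∀ σ ∈ K.faces, ∀ v ∈ σ, x v ∈ relConvexHull F (p '' Φ σ) := by
    intro σ hσ v hv
    refine relConvexHull_mono F (Set.image_mono ?_) (hxmem v (hvert σ hσ v hv))
    have h1 := hΦ σ hσ {v} (hvert σ hσ v hv)
    rw [Finset.inter_singleton_of_mem hv] at h1
    exact h1.trans_subset Set.inter_subset_left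
  obtain ⟨f, hf, hfB⟩ := exists_continuousMap_of_joinedIn hK hd x
    (fun σ => relConvexHull F (p '' Φ σ)) hxmem (by
      intro σ hσ hc u hu v hv
      by_cases huv : u = v
      · exact huv ▸ JoinedIn.refl (hmono σ hσ u hu)
      let s : Simplex K 1 := ⟨σ, hσ, hc⟩
      refine joinedIn_of_boundary (hmono σ hσ u hu) (mem_chainsIn.2 (hsupp 1 s)) ?_
      have happ : ∀ (τ : Simplex K 0) w, τ.1 = {w} → γ.app 0 (Finsupp.single τ 1) =
          Finsupp.single (pointSimplex (x w)) 1 := by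
        rintro ⟨_, hτ, _⟩ w rfl
        exact hx w hτ
      obtain ⟨τ, τ', hτ, hτ', hsum⟩ := simplicialBoundary_edge s hu hv huv
      rw [ChainMap.onSimplex, γ.comm, hsum, map_add, happ τ u hτ, happ τ' v hτ'])
  refine ⟨f, fun {_} => ?_⟩
  let γ' : ChainMap K X :=
    { app := fun n => Finsupp.linearCombination (ZMod 2) fun σ : Simplex K n =>
        Finsupp.single (inducedSimplex f σ) 1
      comm := by
        rintro (_ | n) c
        · induction c using Finsupp.induction_linear with
          | zero => simp
          | add c c' hc hc' => simp only [map_add, hc, hc']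
          | single σ a =>
            have h1 : 1 < #σ.1 := σ.2.2.symm ▸ Nat.one_lt_two
            obtain ⟨u, hu, v, hv, huv⟩ := Finset.one_lt_card.1 h1
            obtain ⟨τ, τ', hτ, hτ', hsum⟩ := simplicialBoundary_edge σ hu hv huv
            rw [← mul_one a, ← smul_eq_mul, ← Finsupp.smul_single, map_smul, map_smul, map_smul,
              map_smul, hsum, map_add]
            simp only [Finsupp.linearCombination_single, one_smul]
            rw [singularBoundary_inducedSimplex hf σ hu hv huv,
              inducedSimplex_zero hf τ (hτ ▸ Finset.mem_singleton_self u),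
              inducedSimplex_zero hf τ' (hτ' ▸ Finset.mem_singleton_self v)]
        · have : IsEmpty (Simplex K (n + 1 + 1)) := ⟨fun σ => by
            have := hd σ.1 σ.2.1
            rw [σ.2.2] at this
            omega⟩
          rw [Subsingleton.elim c 0]
          simp }
  have hγ' : ∀ {n : ℕ} (σ : Simplex K n), γ'.onSimplex σ = Finsupp.single (inducedSimplex f σ) 1 :=
    fun σ => ChainMap.onSimplex_eq (γ := γ')
      (h := fun σ => Finsupp.single (inducedSimplex f σ) 1) rfl σ
  refine ⟨γ', fun n e he => ?_, fun v => ?_, Φ, h0, hΦ, fun n σ => ?_⟩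
  · refine (hγ' _).trans ?_
    congr 1
    refine congrArg f.comp (characteristicMap_congr ?_ _ _)
    congr 1
    refine (Finset.orderEmbOfFin_unique' _ fun i => ?_).symm
    exact Finset.mem_map_of_mem _ (Finset.mem_univ i)
  · obtain ⟨w, hw⟩ := Finset.card_eq_one.1 v.2.2
    rw [hγ', inducedSimplex_zero hf v (v := w) (by rw [hw]; exact Finset.mem_singleton_self w)]
    exact odd_card_support_single _
  · rw [hγ', ← mem_chainsIn]
    refine single_mem_chainsIn ?_
    rintro _ ⟨t, rfl⟩
    refine hfB σ.1 σ.2.1 _ ?_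
    have := characteristicMap_mem _ σ.map_orderEmbOfFin_mem t
    rwa [Finset.map_orderEmbOfFin_univ] at this

end ConstrainedChainMaps

theorem proposition10 {V : Type*} (K : PreAbstractSimplicialComplex V) (hK : K.faces.Finite)
    (b : ℕ) :
    ∃ r : ℕ, ∀ (X : Type*) [TopologicalSpace X] (F : Set (Set X)) (ι : Type*) (p : ι → X),
      F.Finite → topologicalComplexity F (simplicialDim K) ≤ (b : ℕ∞) → (r : ℕ∞) ≤ ENat.card ι →
        (∃ γ : ChainMap K X, γ.Nontrivial ∧ γ.IsConstrainedBy F p) ∧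
        (simplicialDim K ≤ 1 → ∃ f : C(Realization K, X), ∀ [LinearOrder V],
          ∃ γ : ChainMap K X, γ.IsInducedBy f ∧ γ.Nontrivial ∧ γ.IsConstrainedBy F p) := by
  classical
  set S := hK.toFinset with hS
  have hmemS : ∀ σ, σ ∈ S ↔ σ ∈ K.faces := fun σ => hK.mem_toFinset
  set d := S.sup fun σ => σ.card - 1 with hd
  set W := S.biUnion id with hW
  have hdim : ∀ σ ∈ K.faces, ((((σ.card - 1 : ℕ) : ℕ∞)) : WithBot ℕ∞) ≤ simplicialDim K :=
    fun σ hσ => le_iSup₂_of_le (f := fun (σ : Finset V) (_ : σ ∈ K.faces) =>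
      ((((σ.card - 1 : ℕ) : ℕ∞)) : WithBot ℕ∞)) σ hσ le_rfl
  -- The additional vertex makes the number of vertices positive even if `K` is empty.
  let e : V → Fin (W.card + 1) := fun v =>
    if h : v ∈ W then (W.equivFin ⟨v, h⟩).castSucc else Fin.last _
  have he : Set.InjOn e W := by
    intro v hv w hw h
    simp only [e, dif_pos (Finset.mem_coe.1 hv), dif_pos (Finset.mem_coe.1 hw)] at h
    exact congrArg Subtype.val (W.equivFin.injective (Fin.castSucc_injective _ h))
  obtain ⟨r, hr⟩ := exists_isConstrainedSkeleton b d (W.card + 1)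
  refine ⟨r, fun X _ F ι p _ hTC hcard => ?_⟩
  have hbetti : ∀ G ⊆ F, ∀ i < d, reducedBetti (⋂₀ G) i ≤ (b : ℕ∞) := by
    intro G hG i hi
    refine le_trans ?_ hTC
    have hlt : ((i : ℕ∞) : WithBot ℕ∞) < simplicialDim K := by
      obtain ⟨σ, hσ, h⟩ := Finset.lt_sup_iff.1 hi
      refine lt_of_lt_of_le ?_ (hdim σ ((hmemS σ).1 hσ))
      exact_mod_cast h
    exact le_iSup_of_le G (le_iSup_of_le hG (le_iSup_of_le i (le_iSup_of_le hlt le_rfl)))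
  obtain ⟨g, Φ, hg⟩ := hr X F ι p hbetti hcard
  have : Nonempty X := ⟨(hg.vertex 0).choose⟩
  have hcard_le : ∀ σ ∈ K.faces, σ.card ≤ d + 1 := by
    intro σ hσ
    have : σ.card - 1 ≤ d := Finset.le_sup (f := fun σ : Finset V => σ.card - 1) ((hmemS σ).2 hσ)
    omega
  obtain ⟨γ, hγ, hc⟩ := hg.exists_chainMap hcard_le he
    fun σ hσ => Finset.subset_biUnion_of_mem id ((hmemS σ).2 hσ)
  refine ⟨⟨γ, fun v => ?_, hc⟩, fun h1 => exists_isInducedBy hK (fun σ hσ => ?_) hγ hc⟩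
  · obtain ⟨x, hx⟩ := hγ v
    rw [hx]
    exact odd_card_support_single x
  · have h2 := (hdim σ hσ).trans h1
    have h3 : σ.card - 1 ≤ 1 := by exact_mod_cast h2
    omega
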